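/- Let $X$ be a Hausdorff real locally convex space with topological dual $X^*$, let $(T,\Sigma,\mu)$ be a complete $\sigma$-finite measure space, and let $f:T\times X\to\overline{\mathbb R}$ be a convex normal integrand, i.e. $f$ is $\Sigma\otimes\mathcal B(X)$-measurable and, for almost every $t\in T$, the function $f_t:=f(t,\cdot)$ is convex, proper and lower semicontinuous. For $x\in X$ let $I_f(x):=\int_T f(t,x)\,d\mu(t)$ be the upper integral, i.e. the infimum of $\int_T g\,d\mu$ over all $g\in L^1(T,\mathbb R)$ with $f(t,x)\le g(t)$ a.e. ($+\infty$ if there is no such $g$), and let $\operatorname{dom} I_f:=\{x : I_f(x)<+\infty\}$. For $h:X\to\overline{\mathbb R}$ and $\varepsilon\ge 0$ put $\partial_\varepsilon h(x):=\{x^*\in X^* : \langle x^*,y-x\rangle\le h(y)-h(x)+\varepsilon\ \ \forall y\in X\}$ if $h(x)$ is finite and $\partial_\varepsilon h(x):=\emptyset$ otherwise. For $A\subseteq X$ let $N_A^\varepsilon(x):=\partial_\varepsilon\delta_A(x)$, where $\delta_A$ is $0$ on $A$ and $+\infty$ off $A$. For $G:T\rightrightarrows X^*$ let $(w)\text{-}\int_T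 G(t)\,d\mu(t)$ be the set of all $x^*\in X^*$ for which there is $m:T\to X^*$ with $m(t)\in G(t)$ a.e., $\langle m(\cdot),x\rangle\in L^1(T,\mathbb R)$ and $\langle x^*,x\rangle=\int_T\langle m(t),x\rangle\,d\mu(t)$ for every $x\in X$. For $\eta\ge0$ let $\mathcal I(\eta):=\{\ell\in L^1(T,\mathbb R_+):\int_T\ell\,d\mu\le\eta\}$. Assume that either $X$ is a Suslin space (a Hausdorff continuous image of a Polish space) or $(T,\Sigma)=(\mathbb N,\mathcal P(\mathbb N))$. Assume further that $I_f$ is finite and continuous at some point of $X$, and that for almost every $t\in T$ the function $f_t$ is finite and continuous at some point of $X$ (which may depend on $t$). Then, for every $x\in X$ and every $\varepsilon\ge 0$, $$\partial_\varepsilon I_f(x)=\bigcup_{\substack{\varepsilon_1,\varepsilon_2\ge 0,\ \varepsilon_1+\varepsilon_2=\varepsilon\\ \ell\in\mathcal I(\varepsilon_1)}}\left\{(w)\text{-}\int_T\partial_{\ell(t)}f_t(x)\,d\mu(t)+N^{\varepsilon_2}_{\operatorname{dom} I_f}(x)\right\}.$$ -/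

import Mathlib

open MeasureTheory Set
open scoped Pointwise

noncomputable section

namespace ConvexIntegral

/-- A Suslin space: a Hausdorff space that is a continuous image of a Polish space. -/
def IsSuslinSpace (S : Type*) [TopologicalSpace S] : Prop :=
  T2Space S ∧ ∃ (P : Type) (_ : TopologicalSpace P), PolishSpace P ∧
    ∃ g : P → S, Continuous g ∧ Function.Surjective g

section Functions

variable {X : Type*}

/-- The effective domain `{x | h x < +∞}` of an extended-real-valued function. -/
def effDom (h : X → EReal) : Set X := {x | h x < ⊤}

/-- A proper function: nonempty domain, never equal to `-∞`. -/
def IsProper (h : X → EReal) : Prop := (effDom h).Nonempty ∧ ∀ x, ⊥ < h x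

/-- Convexity of an extended-real-valued function, through its epigraph. -/
def IsConvexFun [AddCommGroup X] [Module ℝ X] (h : X → EReal) : Prop :=
  Convex ℝ {p : X × ℝ | h p.1 ≤ (p.2 : EReal)}

/-- `h` is finite and continuous at `x` (continuity in the sense of convex analysis). -/
def IsContinuityPoint [TopologicalSpace X] (h : X → EReal) (x : X) : Prop :=
  ⊥ < h x ∧ h x < ⊤ ∧ ContinuousAt h x

/-- The indicator function of `A`: `0` on `A`, `+∞` off `A`. -/
def indicatorFun (A : Set X) : X → EReal := fun x =>
  open Classical in if x ∈ A then 0 else ⊤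

variable [AddCommGroup X] [Module ℝ X] [TopologicalSpace X]

/-- The `ε`-subdifferential of `h` at `x`, a subset of the topological dual of `X`;
it is empty when `h x` is not finite. -/
def epsSubdiff (h : X → EReal) (ε : ℝ) (x : X) : Set (X →L[ℝ] ℝ) :=
  {φ | ⊥ < h x ∧ h x < ⊤ ∧ ∀ y, ((φ (y - x) : ℝ) : EReal) ≤ h y - h x + (ε : EReal)}

/-- The `ε`-normal set of `A` at `x`. -/
def epsNormal (A : Set X) (ε : ℝ) (x : X) : Set (X →L[ℝ] ℝ) :=
  epsSubdiff (indicatorFun A) ε x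

end Functions

section Integrals

variable {T : Type*} [MeasurableSpace T]

/-- The upper integral: the infimum of `∫ g` over integrable `g` with `h ≤ g` almost everywhere
(equal to `+∞` if there is no such `g`). -/
def upperIntegral (μ : Measure T) (h : T → EReal) : EReal :=
  sInf {r : EReal | ∃ g : T → ℝ, Integrable g μ ∧ (∀ᵐ t ∂μ, h t ≤ (g t : EReal)) ∧
    r = ((∫ t, g t ∂μ : ℝ) : EReal)}

/-- The integral function `I_f (x) = ∫ f(t, x) dμ(t)`. -/
def integralFun {X : Type*} (μ : Measure T) (f : T → X → EReal) : X → EReal :=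
  fun x => upperIntegral μ (fun t => f t x)

/-- The set of nonnegative integrable functions with integral at most `η`. -/
def nonnegIntegrableLE (μ : Measure T) (η : ℝ) : Set (T → ℝ) :=
  {l | Integrable l μ ∧ (∀ t, 0 ≤ l t) ∧ ∫ t, l t ∂μ ≤ η}

variable {X : Type*} [AddCommGroup X] [Module ℝ X] [TopologicalSpace X]

/-- A convex normal integrand: jointly measurable with respect to the product of the
`σ`-algebra of `T` and the Borel `σ`-algebra of `X`, and lower semicontinuous, convex and proper
in the second variable for almost every `t`. -/
def IsConvexNormalIntegrand (μ : Measure T) (f : T → X → EReal) : Prop :=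
  (letI : MeasurableSpace X := borel X; Measurable (fun p : T × X => f p.1 p.2)) ∧
  ∀ᵐ t ∂μ, LowerSemicontinuous (f t) ∧ IsConvexFun (f t) ∧ IsProper (f t)

/-- The weak integral of a multifunction `G` with values in the dual: all continuous linear
functionals of the form `x ↦ ∫ ⟨m(t), x⟩ dμ(t)` with `m` a weak-star integrable
almost-everywhere selection of `G`. -/
def weakIntegral (μ : Measure T) (G : T → Set (X →L[ℝ] ℝ)) : Set (X →L[ℝ] ℝ) :=
  {φ | ∃ m : T → (X →L[ℝ] ℝ), (∀ x, Integrable (fun t => m t x) μ) ∧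
    (∀ᵐ t ∂μ, m t ∈ G t) ∧ ∀ x, φ x = ∫ t, m t x ∂μ}

end Integrals

end ConvexIntegral

end

/-!
Fix a continuity point `x₀` of the integral functional `I_f`, and write `k t y = f t (x₀ + y)`.

The inclusion from right to left is obtained by integrating the pointwise subgradient inequalities
(`add_mem_epsSubdiff_integralFun`). It uses that `I_f` never takes the value `-∞`, by convexity and
finiteness at `x₀` (`bot_lt_integralFun`), so that `I_f y` is an ordinary integral on the domain.

For the converse, `φ ∈ ∂_ε I_f(x)` means that `φ y ≤ ∫ k t y dμ(t) + α` for all `y`, with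
`α = ε - I_f(x) + φ (x - x₀)`. Identify `X` with the constant functions in the space of simple
functions `u : T → X`. As `x₀` is an interior point of the domain, the functional
`u ↦ ∫ k t (u t) dμ(t)` is finite near `0` along every line, so the Hahn–Banach theorem extends `φ`
to a linear functional `Φ` on simple functions with `Φ u ≤ ∫ k t (u t) dμ(t) + α`
(`exists_linear_extension_simpleFunc`).

Each set function `A ↦ Φ (1_A y)` is bounded and finitely additive. In the spirit of Yosida and
Hewitt, `Φ` is split as `Φa + Φs`, where `Φa u` is the limit of `Φ (1_Q u)` along an ultrafilter of
measurable sets `Q` that exhausts `T` (`exists_exhausting_ultrafilter`). The ultrafilter makes the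
splitting linear in `u` at once. The set functions `A ↦ Φa (1_A y)` are countably additive and
absolutely continuous, with densities `ρ y` (`exists_density`). Pasting two simple functions along
`Q` and `Qᶜ` decouples the inequality: `Φa u + Φs v ≤ ∫ k t (u t) dμ(t) + α` whenever `u` and `v`
have finite integrals (`exists_densities`). With `c` the supremum of `Φs` over the constants in the
domain, the first part gives `∫ (ρ (u t) t - k t (u t)) dμ(t) ≤ α - c` for all simple `u`.
Optimizing over `u` yields an integrable `b` with `∫ b ≤ α - c` and `ρ y t - b t ≤ k t y` almost
everywhere, for each `y` (`exists_integrable_gap`).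

It remains to choose `m t ∈ X*` with `m t y = ρ y t` almost everywhere, for each `y`
(`exists_selection`). A Suslin space is separable. On a countable dense subgroup the exceptional
null sets can be united; there `y ↦ ρ y t` is additive and bounded above near a point because `f t`
has a continuity point, hence it is continuous and extends to `X`. If `T` is countable, no dense
subgroup is needed. The functionals `m t` represent the part of `φ` that lies in the weak integral,
the rest of `φ` is an approximate normal to `dom I_f`, and the total error is distributed as
`ε₁ = ∫ l`, `ε₂ = ε - ε₁`, with `l t = f t x - m t (x - x₀) + b t`
(`exists_decomposition_of_mem_epsSubdiff`).
-/

namespace ConvexIntegral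

open Filter Topology

/-! ### Linear functionals: sandwich theorem, ultrafilter limits, extension from dense subgroups -/

/-- Hahn–Banach sandwich theorem. The set `S` plays the role of the epigraph of a convex function
that is finite at some positive multiple of every vector; no topology is involved. -/
theorem exists_linear_extension_le_of_convex {E : Type*} [AddCommGroup E] [Module ℝ E]
    (W : Submodule ℝ E) (φ : E →ₗ[ℝ] ℝ) {S : Set (E × ℝ)} (hS : Convex ℝ S)
    (hW : ∀ w ∈ W, ∀ r, (w, r) ∈ S → φ w ≤ r)
    (habs : ∀ u : E, ∃ s : ℝ, 0 < s ∧ ∃ r, (s • u, r) ∈ S) :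
    ∃ Φ : E →ₗ[ℝ] ℝ, (∀ w ∈ W, Φ w = φ w) ∧ ∀ u r, (u, r) ∈ S → Φ u ≤ r := by
  -- The functional `(u, r) ↦ r - φ u` is nonnegative on the part of the cone generated by `S`
  -- that lies over `W`; it is extended to `E × ℝ` with the same property.
  have hne : S.Nonempty := by
    obtain ⟨s, -, r, h⟩ := habs 0
    exact ⟨_, h⟩
  let K : PointedCone ℝ (E × ℝ) :=
    { carrier := {x | ∃ r : ℝ, 0 ≤ r ∧ x ∈ r • S}
      add_mem' := by
        rintro x y ⟨r, hr, hx⟩ ⟨r', hr', hy⟩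
        refine ⟨r + r', add_nonneg hr hr', ?_⟩
        rw [hS.add_smul hr hr']
        exact Set.add_mem_add hx hy
      zero_mem' := ⟨0, le_rfl, by simp [zero_smul_set hne]⟩
      smul_mem' := by
        rintro c x ⟨r, hr, hx⟩
        refine ⟨c.1 * r, mul_nonneg c.2 hr, ?_⟩
        rw [mul_smul]
        exact Set.smul_mem_smul_set hx }
  have hK : ∀ x, x ∈ K ↔ ∃ r : ℝ, 0 ≤ r ∧ x ∈ r • S := fun x => Iff.rfl
  let ψ : E × ℝ →ₗ[ℝ] ℝ := LinearMap.snd ℝ E ℝ - φ ∘ₗ LinearMap.fst ℝ E ℝ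
  have hψ : ∀ u r, ψ (u, r) = r - φ u := fun u r => rfl
  obtain ⟨g, hg, hgK⟩ := riesz_extension K ⟨W.prod ⊤, ψ.domRestrict (W.prod ⊤)⟩ (by
      rintro ⟨⟨w, r⟩, hw⟩ hx
      obtain ⟨s, hs, ⟨v, q⟩, hvq, heq⟩ := hx
      change 0 ≤ ψ (w, r)
      simp only [Prod.smul_mk, Prod.mk.injEq] at heq
      rw [hψ, ← heq.1, ← heq.2, map_smul, smul_eq_mul, smul_eq_mul, ← mul_sub]
      rcases hs.eq_or_lt with rfl | hs
      · simp
      · have hv : v ∈ W := by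
          have hwW : w ∈ W := hw.1
          rwa [← heq.1, W.smul_mem_iff hs.ne'] at hwW
        exact mul_nonneg hs.le (sub_nonneg.2 (hW v hv q hvq))) (by
      rintro ⟨u, r⟩
      obtain ⟨s, hs, r', h⟩ := habs u
      refine ⟨⟨(0, s⁻¹ * r' - r), ⟨W.zero_mem, trivial⟩⟩, (hK _).2 ⟨s⁻¹, by positivity, ?_⟩⟩
      refine ⟨_, h, ?_⟩
      simp [smul_smul, hs.ne'])
  refine ⟨-(g ∘ₗ LinearMap.inl ℝ E ℝ), fun w hw => ?_, fun u r hur => ?_⟩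
  · have := hg ⟨(w, 0), ⟨hw, trivial⟩⟩
    have h2 : g (w, 0) = ψ (w, 0) := this
    simp [h2, hψ]
  · have h1 : 0 ≤ g (u, r) := hgK _ ((hK _).2 ⟨1, zero_le_one, by simpa using hur⟩)
    have h2 : g (0, r) = ψ (0, r) := hg ⟨(0, r), ⟨W.zero_mem, trivial⟩⟩
    have h3 : g (u, r) = g (u, 0) + g (0, r) := by rw [← map_add]; simp
    simp only [LinearMap.neg_apply, LinearMap.comp_apply, LinearMap.inl_apply]
    rw [h3, h2, hψ, map_zero] at h1
    linarith

/-- Pointwise limits of linear functionals along an ultrafilter: they exist as soon as the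
functionals are pointwise bounded, and they depend linearly on the vector. -/
theorem exists_linear_ultrafilter_limit {ι E : Type*} [AddCommGroup E] [Module ℝ E]
    (U : Ultrafilter ι) (L : ι → E →ₗ[ℝ] ℝ) (hL : ∀ u, ∃ C, ∀ i, |L i u| ≤ C) :
    ∃ Λ : E →ₗ[ℝ] ℝ, ∀ u, Tendsto (fun i => L i u) U (𝓝 (Λ u)) := by
  have key : ∀ u, ∃ a, Tendsto (fun i => L i u) U (𝓝 a) := by
    intro u
    obtain ⟨C, hC⟩ := hL u
    obtain ⟨a, -, ha⟩ := (isCompact_Icc (a := -C) (b := C)).ultrafilter_le_nhds'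
      (U.map fun i => L i u) (by
        rw [Ultrafilter.mem_map]
        exact Filter.univ_mem' fun i => abs_le.1 (hC i))
    exact ⟨a, ha⟩
  choose a ha using key
  refine ⟨{ toFun := a, map_add' := fun u v => ?_, map_smul' := fun c u => ?_ }, ha⟩
  · refine tendsto_nhds_unique (ha (u + v)) ?_
    simpa only [map_add] using (ha u).add (ha v)
  · refine tendsto_nhds_unique (ha (c • u)) ?_
    simpa only [map_smul, smul_eq_mul, RingHom.id_apply] using (ha u).const_mul c

/-- Subgroups of topological vector spaces are the intended case, so only integer multiples are
available in the argument. -/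
theorem continuous_of_bddAbove_near {G : Type*} [AddCommGroup G] [TopologicalSpace G]
    [IsTopologicalAddGroup G] (ρ : G →+ ℝ) {g : G} {N : ℝ} (h : ∀ᶠ x in 𝓝 g, ρ x ≤ N) :
    Continuous ρ := by
  refine continuous_of_continuousAt_zero ρ ?_
  rw [ContinuousAt, map_zero, Metric.tendsto_nhds]
  intro δ hδ
  have h0 : ∀ᶠ x in 𝓝 (0 : G), ρ x ≤ N - ρ g := by
    have : Tendsto (fun x => g + x) (𝓝 0) (𝓝 g) := by
      simpa using (continuous_const_add g).tendsto 0
    filter_upwards [this.eventually h] with x hx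
    rw [map_add] at hx
    linarith
  have hneg : ∀ᶠ x in 𝓝 (0 : G), ρ (-x) ≤ N - ρ g := by
    have : Tendsto (fun x : G => -x) (𝓝 0) (𝓝 0) := by
      simpa using continuous_neg.tendsto (0 : G)
    exact this.eventually h0
  have hC : 0 ≤ N - ρ g := by simpa using h0.self_of_nhds
  obtain ⟨n, hn⟩ := exists_nat_gt ((N - ρ g) / δ)
  have hn0 : (0 : ℝ) < n := lt_of_le_of_lt (by positivity) hn
  have hmul : Tendsto (fun x : G => n • x) (𝓝 0) (𝓝 0) := by
    simpa using (continuous_nsmul n).tendsto (0 : G)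
  filter_upwards [hmul.eventually (h0.and hneg)] with x hx
  rw [div_lt_iff₀ hδ] at hn
  simp only [map_neg, map_nsmul, nsmul_eq_mul] at hx
  rw [Real.dist_eq, sub_zero, abs_lt]
  constructor
  · by_contra hcon
    push Not at hcon
    nlinarith [hx.2]
  · by_contra hcon
    push Not at hcon
    nlinarith [hx.1]

/-- The extension is continuous and additive, which makes it real-linear. -/
theorem exists_continuousLinearMap_extension {X : Type*} [AddCommGroup X] [Module ℝ X]
    [TopologicalSpace X] [IsTopologicalAddGroup X] [ContinuousSMul ℝ X] {D : AddSubgroup X}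
    (hD : Dense (D : Set X)) (ρ : D →+ ℝ) (hρ : Continuous ρ) :
    ∃ m : X →L[ℝ] ℝ, ∀ d : D, m d = ρ d := by
  let _ : UniformSpace X := IsTopologicalAddGroup.rightUniformSpace X
  have : IsUniformAddGroup X := isUniformAddGroup_of_addCommGroup
  have hu : UniformContinuous ρ := uniformContinuous_addMonoidHom_of_continuous hρ
  have hc : Continuous (hD.extend ρ) := (hD.uniformContinuous_extend hu).continuous
  have heq : ∀ d : D, hD.extend ρ d = ρ d := fun d => hD.extend_eq hρ d
  have hadd : ∀ x y, hD.extend ρ (x + y) = hD.extend ρ x + hD.extend ρ y := by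
    intro x y
    have hcl : IsClosed {p : X × X |
        hD.extend ρ (p.1 + p.2) = hD.extend ρ p.1 + hD.extend ρ p.2} :=
      isClosed_eq (by fun_prop) (by fun_prop)
    refine closure_minimal (s := (D : Set X) ×ˢ (D : Set X)) ?_ hcl (hD.prod hD (x, y))
    · rintro ⟨a, b⟩ ⟨ha, hb⟩
      have := heq (⟨a, ha⟩ + ⟨b, hb⟩)
      rw [map_add] at this
      simpa [← heq] using this
  exact ⟨(AddMonoidHom.mk' (hD.extend ρ) hadd).toRealLinearMap hc, heq⟩

/-! ### Integrable minorants and essential suprema -/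

section MeasureLemmas

open scoped ENNReal NNReal

variable {T : Type*} [MeasurableSpace T] {μ : Measure T}

/-- By `σ`-finiteness, a nonnegative function is approximated in integral by integrable minorants;
it need not be measurable. -/
theorem lintegral_le_ofReal_of_integrable_minorants [SigmaFinite μ] {w : T → ℝ≥0} {β : ℝ}
    (h : ∀ κ : T → ℝ, Integrable κ μ → (∀ t, 0 ≤ κ t) → (∀ t, κ t ≤ w t) → ∫ t, κ t ∂μ ≤ β) :
    ∫⁻ t, w t ∂μ ≤ ENNReal.ofReal β := by
  by_contra hcon
  push Not at hcon
  obtain ⟨g, hgw, hgt, hg⟩ := exists_lt_lintegral_simpleFunc_of_lt_lintegral hcon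
  have hmeas : Measurable fun t => (g t : ℝ) := g.measurable.coe_nnreal_real
  have hlin : ∫⁻ t, ENNReal.ofReal (g t : ℝ) ∂μ = ∫⁻ t, g t ∂μ := by simp
  have hnn : 0 ≤ᵐ[μ] fun t => (g t : ℝ) := ae_of_all _ fun t => NNReal.coe_nonneg _
  have hint : Integrable (fun t => (g t : ℝ)) μ := by
    refine ⟨hmeas.aestronglyMeasurable, ?_⟩
    rw [hasFiniteIntegral_iff_ofReal hnn, hlin]
    exact hgt
  have hle := h _ hint (fun t => NNReal.coe_nonneg _) fun t => NNReal.coe_le_coe.2 (hgw t)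
  rw [integral_eq_lintegral_of_nonneg_ae hnn
    hmeas.aestronglyMeasurable, hlin] at hle
  exact absurd (ENNReal.le_ofReal_iff_toReal_le hgt.ne
    (ENNReal.toReal_nonneg.trans hle) |>.2 hle) (not_le.2 hg)

/-- The hypothesis `hc` says that the upper integral of `h` is not `-∞`. -/
theorem integrable_of_integrable_majorants [SigmaFinite μ] {h g₀ : T → ℝ} {c : ℝ}
    (hh : AEStronglyMeasurable h μ) (hg₀ : Integrable g₀ μ) (hle : ∀ᵐ t ∂μ, h t ≤ g₀ t)
    (hc : ∀ g : T → ℝ, Integrable g μ → (∀ᵐ t ∂μ, h t ≤ g t) → c ≤ ∫ t, g t ∂μ) :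
    Integrable h μ := by
  have hfin : ∫⁻ t, ENNReal.ofReal (g₀ t - h t) ∂μ ≤ ENNReal.ofReal (∫ t, g₀ t ∂μ - c) := by
    refine lintegral_le_ofReal_of_integrable_minorants (w := fun t => (g₀ t - h t).toNNReal) ?_
    intro κ hκ _ hκw
    have := hc (fun t => g₀ t - κ t) (hg₀.sub hκ) ?_
    · rw [integral_sub hg₀ hκ] at this
      linarith
    · filter_upwards [hle] with t ht
      have := hκw t
      rw [Real.coe_toNNReal _ (sub_nonneg.2 ht)] at this
      linarith
  have hsub : Integrable (fun t => g₀ t - h t) μ := by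
    refine ⟨hg₀.aestronglyMeasurable.sub hh, ?_⟩
    rw [hasFiniteIntegral_iff_ofReal (hle.mono fun t ht => sub_nonneg.2 ht)]
    exact hfin.trans_lt ENNReal.ofReal_lt_top
  refine (hg₀.sub hsub).congr (ae_of_all _ fun t => ?_)
  simp

/-- An essential supremum for an arbitrary family: it is the supremum of an increasing sequence of
finite suprema whose integrals tend to the largest possible value. -/
theorem exists_measurable_ae_upper_bound {ι : Type*} {h : ι → T → ℝ≥0∞} {K : ℝ≥0∞}
    (hmeas : ∀ i, Measurable (h i)) (hK : K ≠ ∞)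
    (hfin : ∀ F : Finset ι, ∫⁻ t, F.sup (fun i => h i t) ∂μ ≤ K) :
    ∃ b : T → ℝ≥0∞, Measurable b ∧ ∫⁻ t, b t ∂μ ≤ K ∧ ∀ i, ∀ᵐ t ∂μ, h i t ≤ b t := by
  classical
  let G : Finset ι → ℝ≥0∞ := fun F => ∫⁻ t, F.sup (fun i => h i t) ∂μ
  have hFm : ∀ F : Finset ι, Measurable fun t => F.sup (fun i => h i t) := by
    intro F
    simp only [Finset.sup_eq_iSup]
    exact Measurable.biSup _ F.countable_toSet fun i _ => hmeas i
  obtain ⟨u, -, hu, hur⟩ := exists_seq_tendsto_sSup (range_nonempty G) (OrderTop.bddAbove _)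
  choose F hF using hur
  have hF'mono : Monotone (partialSups F) := (partialSups F).monotone
  let b : T → ℝ≥0∞ := fun t => ⨆ n, (partialSups F n).sup (fun i => h i t)
  have hb : Measurable b := Measurable.iSup fun n => hFm _
  have hsb : sSup (range G) ≤ ∫⁻ t, b t ∂μ := by
    refine le_of_tendsto hu (Eventually.of_forall fun n => ?_)
    rw [← hF n]
    refine lintegral_mono fun t => ?_
    exact (Finset.sup_mono (le_partialSups F n)).trans
      (le_iSup (fun n => (partialSups F n).sup (fun i => h i t)) n)
  have hbsup : ∀ F₀ : Finset ι, ∫⁻ t, F₀.sup (fun i => h i t) ⊔ b t ∂μ ≤ sSup (range G) := by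
    intro F₀
    have heq : ∀ t, F₀.sup (fun i => h i t) ⊔ b t =
        ⨆ n, (F₀ ∪ partialSups F n).sup (fun i => h i t) := by
      intro t
      simp only [b, Finset.sup_union, sup_iSup]
    simp only [heq]
    rw [lintegral_iSup (fun n => hFm _)]
    · exact iSup_le fun n => le_sSup ⟨_, rfl⟩
    · intro m n hmn t
      exact Finset.sup_mono (Finset.union_subset_union_right (hF'mono hmn))
  have hsK : sSup (range G) ≤ K := sSup_le (by rintro _ ⟨F, rfl⟩; exact hfin F)
  have hbK : ∫⁻ t, b t ∂μ ≤ sSup (range G) := by simpa using hbsup ∅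
  refine ⟨b, hb, hbK.trans hsK, fun i => ?_⟩
  have hi := hbsup {i}
  simp only [Finset.sup_singleton] at hi
  have := ae_eq_of_ae_le_of_lintegral_le (μ := μ) (f := b) (g := fun t => h i t ⊔ b t)
    (ae_of_all _ fun t => le_sup_right) (ne_top_of_le_ne_top hK (hbK.trans hsK))
    ((hmeas i).sup hb).aemeasurable (hi.trans hsb)
  filter_upwards [this] with t ht
  rw [ht]
  exact le_sup_left

end MeasureLemmas

/-! ### Extension to simple functions -/

section Majorants

variable {X : Type*} {T : Type*} [MeasurableSpace T]

/-- `g` is an integrable majorant of `t ↦ k t (u t)`. The integral functional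
`u ↦ ∫ k t (u t) dμ(t)` enters only through the integrals of such majorants. -/
def IsIntegrableMajorant (μ : Measure T) (k : T → X → EReal) (u : T → X) (g : T → ℝ) : Prop :=
  Integrable g μ ∧ ∀ᵐ t ∂μ, k t (u t) ≤ (g t : EReal)

variable {μ : Measure T} {k : T → X → EReal}

open Classical in
theorem IsIntegrableMajorant.piecewise {u v : T → X} {g g' : T → ℝ} {Q : Set T}
    (hQ : MeasurableSet Q) (hu : IsIntegrableMajorant μ k u g)
    (hv : IsIntegrableMajorant μ k v g') :
    IsIntegrableMajorant μ k (Q.piecewise u v) (Q.piecewise g g') := by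
  refine ⟨Integrable.piecewise hQ hu.1.integrableOn hv.1.integrableOn, ?_⟩
  filter_upwards [hu.2, hv.2] with t h1 h2
  by_cases ht : t ∈ Q <;> simp [ht, h1, h2]

variable [AddCommGroup X] [Module ℝ X]

theorem IsConvexFun.le_of_le {h : X → EReal} (hh : IsConvexFun h) {y z : X} {r s a b : ℝ}
    (hy : h y ≤ r) (hz : h z ≤ s) (ha : 0 ≤ a) (hb : 0 ≤ b) (hab : a + b = 1) :
    h (a • y + b • z) ≤ ((a * r + b * s : ℝ) : EReal) :=
  hh (x := (y, r)) hy (y := (z, s)) hz ha hb hab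

/-- A simple function takes finitely many values, so it inherits integrability of small multiples
from the constants. -/
theorem eventually_exists_majorant_smul
    (habs : ∀ y, ∀ᶠ s in 𝓝[>] (0 : ℝ), ∃ g, IsIntegrableMajorant μ k (fun _ => s • y) g)
    (u : SimpleFunc T X) :
    ∀ᶠ s in 𝓝[>] (0 : ℝ), ∃ g, IsIntegrableMajorant μ k (s • u : SimpleFunc T X) g := by
  filter_upwards [(Finset.eventually_all u.range).2 fun y _ => habs y] with s hs
  choose! g hg using hs
  refine ⟨fun t => ∑ y ∈ u.range, |g y t|,
    integrable_finsetSum _ fun y hy => (hg y hy).1.abs, ?_⟩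
  have hall : ∀ᵐ t ∂μ, ∀ y ∈ u.range, k t (s • y) ≤ (g y t : EReal) :=
    (ae_ball_iff u.range.countable_toSet).2 fun y hy => (hg y hy).2
  filter_upwards [hall] with t ht
  refine (ht (u t) (u.mem_range_self t)).trans (EReal.coe_le_coe_iff.2 ((le_abs_self _).trans ?_))
  exact Finset.single_le_sum (f := fun y => |g y t|) (fun y _ => abs_nonneg _)
    (u.mem_range_self t)

/-- A linear functional on `X` that is dominated, up to `α`, by the integral functional on constant
functions extends to all simple functions with the same domination. -/
theorem exists_linear_extension_simpleFunc
    (hconv : ∀ᵐ t ∂μ, IsConvexFun (k t))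
    (habs : ∀ y, ∀ᶠ s in 𝓝[>] (0 : ℝ), ∃ g, IsIntegrableMajorant μ k (fun _ => s • y) g)
    {φ : X →ₗ[ℝ] ℝ} {α : ℝ}
    (hφ : ∀ y g, IsIntegrableMajorant μ k (fun _ => y) g → φ y ≤ ∫ t, g t ∂μ + α) :
    ∃ Φ : SimpleFunc T X →ₗ[ℝ] ℝ, (∀ y, Φ (SimpleFunc.const T y) = φ y) ∧
      ∀ (u : SimpleFunc T X) g, IsIntegrableMajorant μ k u g → Φ u ≤ ∫ t, g t ∂μ + α := by
  rcases isEmpty_or_nonempty T with hT | ⟨⟨t₀⟩⟩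
  · -- Every function on the empty set is a majorant with integral `0`, so `φ` is bounded above.
    have hα : ∀ y, φ y ≤ α := by
      intro y
      simpa using hφ y 0 ⟨integrable_zero _ _ _, ae_of_all _ fun t => isEmptyElim t⟩
    refine ⟨0, fun y => ?_, fun u g _ => ?_⟩
    · have h1 : ∀ n : ℕ, n * |φ y| ≤ α := by
        intro n
        rcases abs_choice (φ y) with h | h <;> rw [h]
        · simpa using hα ((n : ℝ) • y)
        · simpa using hα (-((n : ℝ) • y))
      by_contra hne
      have hpos : 0 < |φ y| := abs_pos.2 fun h => hne (by simp [h])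
      obtain ⟨n, hn⟩ := exists_nat_gt (α / |φ y|)
      rw [div_lt_iff₀ hpos] at hn
      exact absurd (h1 n) (not_le.2 hn)
    · simpa [Measure.eq_zero_of_isEmpty μ] using hα 0
  · let ev : SimpleFunc T X →ₗ[ℝ] X :=
      { toFun := fun u => u t₀, map_add' := fun _ _ => rfl, map_smul' := fun _ _ => rfl }
    let co : X →ₗ[ℝ] SimpleFunc T X :=
      { toFun := fun y => SimpleFunc.const T y, map_add' := fun _ _ => rfl,
        map_smul' := fun _ _ => rfl }
    let S : Set (SimpleFunc T X × ℝ) :=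
      {p | ∃ g, IsIntegrableMajorant μ k p.1 g ∧ ∫ t, g t ∂μ + α ≤ p.2}
    have hS : Convex ℝ S := by
      rintro ⟨u, r⟩ ⟨g, hg, hr⟩ ⟨u', r'⟩ ⟨g', hg', hr'⟩ a b ha hb hab
      refine ⟨fun t => a * g t + b * g' t, ⟨(hg.1.const_mul a).add (hg'.1.const_mul b), ?_⟩, ?_⟩
      · filter_upwards [hconv, hg.2, hg'.2] with t h h1 h2
        exact h.le_of_le h1 h2 ha hb hab
      · rw [integral_add (hg.1.const_mul a) (hg'.1.const_mul b), integral_const_mul,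
          integral_const_mul]
        have hb' : b = 1 - a := by linarith
        subst hb'
        change _ ≤ a * r + (1 - a) * r'
        nlinarith [mul_le_mul_of_nonneg_left hr ha, mul_le_mul_of_nonneg_left hr' hb]
    have hW : ∀ u ∈ LinearMap.range co, ∀ r, (u, r) ∈ S → (φ ∘ₗ ev) u ≤ r := by
      rintro _ ⟨y, rfl⟩ r ⟨g, hg, hr⟩
      exact (hφ y g hg).trans hr
    have hS' : ∀ u : SimpleFunc T X, ∃ s : ℝ, 0 < s ∧ ∃ r, (s • u, r) ∈ S := by
      intro u
      obtain ⟨s, ⟨g, hg⟩, hs⟩ :=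
        ((eventually_exists_majorant_smul habs u).and self_mem_nhdsWithin).exists
      exact ⟨s, hs, _, g, hg, le_rfl⟩
    obtain ⟨Φ, hΦ, hΦS⟩ := exists_linear_extension_le_of_convex _ _ hS hW hS'
    exact ⟨Φ, fun y => hΦ (co y) ⟨y, rfl⟩, fun u g hg => hΦS u _ ⟨g, hg, le_rfl⟩⟩

/-- The finitely additive set functions `A ↦ Φ (1_A u)` are bounded. -/
theorem exists_bound_restrict
    (habs : ∀ y, ∀ᶠ s in 𝓝[>] (0 : ℝ), ∃ g, IsIntegrableMajorant μ k (fun _ => s • y) g)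
    {Φ : SimpleFunc T X →ₗ[ℝ] ℝ} {α : ℝ}
    (hΦ : ∀ (u : SimpleFunc T X) g, IsIntegrableMajorant μ k u g → Φ u ≤ ∫ t, g t ∂μ + α)
    (u : SimpleFunc T X) : ∃ C, ∀ Q : Set T, |Φ (u.restrict Q)| ≤ C := by
  classical
  have key : ∀ u : SimpleFunc T X, ∃ C, ∀ Q : Set T, Φ (u.restrict Q) ≤ C := by
    intro u
    obtain ⟨s, ⟨⟨g, hg⟩, g₀, hg₀⟩, hs⟩ := (((eventually_exists_majorant_smul habs u).and
      (habs 0)).and self_mem_nhdsWithin).exists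
    have hs : 0 < s := hs
    refine ⟨max 0 (s⁻¹ * (∫ t, (|g t| + |g₀ t|) ∂μ + α)), fun Q => ?_⟩
    by_cases hQ : MeasurableSet Q
    · refine le_max_of_le_right ?_
      rw [inv_mul_eq_div, le_div_iff₀' hs, ← smul_eq_mul, ← map_smul]
      refine hΦ _ _ ⟨hg.1.abs.add hg₀.1.abs, ?_⟩
      filter_upwards [hg.2, hg₀.2] with t h1 h2
      by_cases ht : t ∈ Q
      · have : (s • u.restrict Q) t = (s • u) t := by
          simp [SimpleFunc.restrict_apply _ hQ, ht]
        rw [this]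
        refine h1.trans (EReal.coe_le_coe_iff.2 ?_)
        linarith [le_abs_self (g t), abs_nonneg (g₀ t)]
      · have : (s • u.restrict Q) t = s • (0 : X) := by
          simp [SimpleFunc.restrict_apply _ hQ, ht]
        rw [this]
        refine h2.trans (EReal.coe_le_coe_iff.2 ?_)
        linarith [le_abs_self (g₀ t), abs_nonneg (g t)]
    · rw [SimpleFunc.restrict_of_not_measurable hQ, map_zero]
      exact le_max_left _ _
  obtain ⟨C, hC⟩ := key u
  obtain ⟨C', hC'⟩ := key (-u)
  refine ⟨max C C', fun Q => abs_le'.2 ⟨(hC Q).trans (le_max_left _ _), ?_⟩⟩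
  have : (-u).restrict Q = -(u.restrict Q) := by
    by_cases hQ : MeasurableSet Q
    · ext t
      by_cases ht : t ∈ Q <;> simp [SimpleFunc.restrict_apply _ hQ, ht]
    · simp [SimpleFunc.restrict_of_not_measurable hQ]
  rw [← map_neg, ← this]
  exact (hC' Q).trans (le_max_right _ _)

end Majorants

/-! ### Exhausting ultrafilters -/

section Exhaustion

variable {T : Type*} [MeasurableSpace T]

/-- There is an ultrafilter of measurable sets `Q` along which every measurable `w : T → ℕ` is
bounded on `Q` and every integrable function has vanishing integral over `Qᶜ`. Finitely many such
requirements are met by a set `{w ≤ n}` with `n` large. -/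
theorem exists_exhausting_ultrafilter (μ : Measure T) :
    ∃ U : Ultrafilter (Set T), (∀ᶠ Q in (U : Filter (Set T)), MeasurableSet Q) ∧
      (∀ w : T → ℕ, Measurable w → ∀ᶠ Q in (U : Filter (Set T)), ∃ n, ∀ t ∈ Q, w t ≤ n) ∧
      ∀ g : T → ℝ, Integrable g μ →
        Tendsto (fun Q : Set T => ∫ t in Qᶜ, g t ∂μ) U (𝓝 0) := by
  let ι := {p : (T → ℕ) × (T → ℝ) // Measurable p.1 ∧ Integrable p.2 μ ∧ ∀ t, 0 ≤ p.2 t}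
  let S : ι → Set (Set T) := fun p =>
    {Q | MeasurableSet Q ∧ (∃ n, ∀ t ∈ Q, p.1.1 t ≤ n) ∧ ∫ t in Qᶜ, p.1.2 t ∂μ ≤ 1}
  have : Nonempty ι := ⟨⟨(0, 0), measurable_const, integrable_zero _ _ _, fun _ => le_rfl⟩⟩
  have hdir : Directed (· ≥ ·) fun p => 𝓟 (S p) := by
    rintro ⟨⟨w, h⟩, hw, hh, h0⟩ ⟨⟨w', h'⟩, hw', hh', h0'⟩
    refine ⟨⟨(fun t => max (w t) (w' t), fun t => h t + h' t), hw.max hw', hh.add hh',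
      fun t => add_nonneg (h0 t) (h0' t)⟩, ?_, ?_⟩
    · refine principal_mono.2 ?_
      rintro Q ⟨hQ, ⟨n, hn⟩, hI⟩
      refine ⟨hQ, ⟨n, fun t ht => (le_max_left _ _).trans (hn t ht)⟩, le_trans ?_ hI⟩
      exact integral_mono hh.integrableOn (hh.add hh').integrableOn
        fun t => le_add_of_nonneg_right (h0' t)
    · refine principal_mono.2 ?_
      rintro Q ⟨hQ, ⟨n, hn⟩, hI⟩
      refine ⟨hQ, ⟨n, fun t ht => (le_max_right _ _).trans (hn t ht)⟩, le_trans ?_ hI⟩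
      exact integral_mono hh'.integrableOn (hh.add hh').integrableOn
        fun t => le_add_of_nonneg_left (h0 t)
  have hne : ∀ p, NeBot (𝓟 (S p)) := by
    rintro ⟨⟨w, h⟩, hw, hh, h0⟩
    rw [principal_neBot_iff]
    have hm : ∀ n : ℕ, MeasurableSet {t | n < w t} := fun n => measurableSet_lt measurable_const hw
    have hlim := tendsto_setIntegral_of_antitone (μ := μ) (f := h) (s := fun n : ℕ => {t | n < w t})
      hm (fun m n hmn t (ht : n < w t) => lt_of_le_of_lt hmn ht) ⟨0, hh.integrableOn⟩
    have hempty : ⋂ n : ℕ, {t | n < w t} = ∅ :=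
      eq_empty_of_forall_notMem fun t ht => lt_irrefl (w t) (mem_iInter.1 ht (w t))
    rw [hempty, setIntegral_empty] at hlim
    obtain ⟨n, hn⟩ := (hlim.eventually (gt_mem_nhds zero_lt_one)).exists
    refine ⟨{t | n < w t}ᶜ, (hm n).compl, ⟨n, fun t ht => not_lt.1 ht⟩, ?_⟩
    rw [compl_compl]
    exact hn.le
  have hF : NeBot (⨅ p, 𝓟 (S p)) := iInf_neBot_of_directed' hdir hne
  have hmem : ∀ p, S p ∈ (Ultrafilter.of (⨅ p, 𝓟 (S p)) : Filter (Set T)) := fun p =>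
    Ultrafilter.of_le _ (mem_iInf_of_mem p (mem_principal_self _))
  refine ⟨Ultrafilter.of (⨅ p, 𝓟 (S p)), ?_, fun w hw => ?_, fun g hg => ?_⟩
  · filter_upwards [hmem this.some] with Q hQ using hQ.1
  · filter_upwards [hmem ⟨(w, 0), hw, integrable_zero _ _ _, fun _ => le_rfl⟩] with Q hQ
      using hQ.2.1
  · rw [Metric.tendsto_nhds]
    intro δ hδ
    filter_upwards [hmem ⟨(0, fun t => (2 / δ) * |g t|), measurable_const, hg.abs.const_mul _,
      fun t => by positivity⟩] with Q hQ
    have h1 : ∫ t in Qᶜ, (2 / δ) * |g t| ∂μ ≤ 1 := hQ.2.2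
    rw [integral_const_mul, div_mul_eq_mul_div, div_le_one hδ] at h1
    rw [Real.dist_eq, sub_zero]
    have := abs_integral_le_integral_abs (f := g) (μ := μ.restrict Qᶜ)
    linarith [abs_nonneg (∫ t in Qᶜ, g t ∂μ)]

end Exhaustion

/-! ### Countable additivity and densities -/

section Density

variable {X : Type*} [AddCommGroup X] {T : Type*} [MeasurableSpace T]

theorem restrict_union_of_disjoint (u : SimpleFunc T X) {A B : Set T} (hA : MeasurableSet A)
    (hB : MeasurableSet B) (hAB : Disjoint A B) :
    u.restrict (A ∪ B) = u.restrict A + u.restrict B := by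
  ext t
  simp [SimpleFunc.restrict_apply, hA, hB, hA.union hB, indicator_union_of_disjoint hAB]

theorem restrict_restrict (u : SimpleFunc T X) {A B : Set T} (hA : MeasurableSet A)
    (hB : MeasurableSet B) : (u.restrict A).restrict B = u.restrict (A ∩ B) := by
  ext t
  rw [SimpleFunc.restrict_apply _ hB, SimpleFunc.restrict_apply _ (hA.inter hB),
    SimpleFunc.coe_restrict _ hA, indicator_indicator, inter_comm]

variable [Module ℝ X]

/-- Restriction of simple functions to a set, as a linear map. -/
noncomputable def restrictLinearMap (X : Type*) [AddCommGroup X] [Module ℝ X] (Q : Set T) :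
    SimpleFunc T X →ₗ[ℝ] SimpleFunc T X where
  toFun u := u.restrict Q
  map_add' u v := by
    by_cases hQ : MeasurableSet Q
    · ext t
      by_cases ht : t ∈ Q <;> simp [SimpleFunc.restrict_apply _ hQ, ht]
    · simp [SimpleFunc.restrict_of_not_measurable hQ]
  map_smul' c u := by
    by_cases hQ : MeasurableSet Q
    · ext t
      by_cases ht : t ∈ Q <;> simp [SimpleFunc.restrict_apply _ hQ, ht]
    · simp [SimpleFunc.restrict_of_not_measurable hQ]

variable {μ : Measure T} {Φ Φa : SimpleFunc T X →ₗ[ℝ] ℝ} {U : Ultrafilter (Set T)}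

/-- The limit `Φa` is uniformly small on sets far out in the partition given by `w`. This is where
the singular part of `Φ` is discarded, and it implies countable additivity. -/
theorem exists_tail_le (hbdd : ∀ u : SimpleFunc T X, ∃ C, ∀ Q : Set T, |Φ (u.restrict Q)| ≤ C)
    (hUm : ∀ᶠ Q in (U : Filter (Set T)), MeasurableSet Q)
    (hUw : ∀ w : T → ℕ, Measurable w → ∀ᶠ Q in (U : Filter (Set T)), ∃ n, ∀ t ∈ Q, w t ≤ n)
    (hlim : ∀ u, Tendsto (fun Q => Φ (u.restrict Q)) U (𝓝 (Φa u)))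
    (u : SimpleFunc T X) {w : T → ℕ} (hw : Measurable w) {δ : ℝ} (hδ : 0 < δ) :
    ∃ K, ∀ B, MeasurableSet B → (∀ t ∈ B, K < w t) → Φa (u.restrict B) ≤ δ := by
  let S : Set ℝ := {r | ∃ B, MeasurableSet B ∧ (∃ n, ∀ t ∈ B, w t ≤ n) ∧ Φ (u.restrict B) = r}
  have hS : S.Nonempty := ⟨_, ∅, MeasurableSet.empty, ⟨0, by simp⟩, rfl⟩
  have hSb : BddAbove S := by
    obtain ⟨C, hC⟩ := hbdd u
    exact ⟨C, by rintro _ ⟨B, -, -, rfl⟩; exact (le_abs_self _).trans (hC B)⟩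
  -- A set `A` that nearly attains the supremum leaves room for at most `δ` outside `{w ≤ K}`.
  obtain ⟨_, ⟨A, hA, ⟨K, hK⟩, rfl⟩, hlt⟩ := exists_lt_of_lt_csSup hS (sub_lt_self (sSup S) hδ)
  refine ⟨K, fun B hB hBK => ?_⟩
  refine le_of_tendsto (hlim (u.restrict B)) ?_
  filter_upwards [hUm, hUw w hw] with Q hQ ⟨n, hn⟩
  rw [restrict_restrict u hB hQ]
  have hdisj : Disjoint (B ∩ Q) A := Set.disjoint_left.2 fun t ht htA =>
    absurd (hBK t ht.1) (not_lt.2 (hK t htA))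
  have hmem : Φ (u.restrict ((B ∩ Q) ∪ A)) ∈ S := by
    refine ⟨_, (hB.inter hQ).union hA, ⟨max n K, ?_⟩, rfl⟩
    rintro t (ht | ht)
    · exact (hn t ht.2).trans (le_max_left _ _)
    · exact (hK t ht).trans (le_max_right _ _)
  have hle := le_csSup hSb hmem
  rw [restrict_union_of_disjoint u (hB.inter hQ) hA hdisj, map_add] at hle
  linarith

/-- The limit functional has a Radon–Nikodym density in every direction `u`. -/
theorem exists_density [SigmaFinite μ]
    (hbdd : ∀ u : SimpleFunc T X, ∃ C, ∀ Q : Set T, |Φ (u.restrict Q)| ≤ C)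
    (hUm : ∀ᶠ Q in (U : Filter (Set T)), MeasurableSet Q)
    (hUw : ∀ w : T → ℕ, Measurable w → ∀ᶠ Q in (U : Filter (Set T)), ∃ n, ∀ t ∈ Q, w t ≤ n)
    (hlim : ∀ u, Tendsto (fun Q => Φ (u.restrict Q)) U (𝓝 (Φa u)))
    (hnull : ∀ u : SimpleFunc T X, ∀ A, MeasurableSet A → μ A = 0 → Φ (u.restrict A) = 0)
    (u : SimpleFunc T X) :
    ∃ ρ : T → ℝ, Measurable ρ ∧ Integrable ρ μ ∧
      ∀ A, MeasurableSet A → Φa (u.restrict A) = ∫ t in A, ρ t ∂μ := by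
  classical
  have habs : ∀ {w : T → ℕ}, Measurable w → ∀ δ > 0,
      ∃ K, ∀ B, MeasurableSet B → (∀ t ∈ B, K < w t) → |Φa (u.restrict B)| ≤ δ := by
    intro w hw δ hδ
    obtain ⟨K, hK⟩ := exists_tail_le hbdd hUm hUw hlim u hw hδ
    obtain ⟨K', hK'⟩ := exists_tail_le hbdd hUm hUw hlim (-u) hw hδ
    refine ⟨max K K', fun B hB h => abs_le'.2
      ⟨hK B hB fun t ht => (le_max_left _ _).trans_lt (h t ht), ?_⟩⟩
    have := hK' B hB fun t ht => (le_max_right _ _).trans_lt (h t ht)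
    rwa [show (-u).restrict B = -(u.restrict B) from map_neg (restrictLinearMap X B) u,
      map_neg] at this
  let ν : SignedMeasure T :=
    { measureOf' := fun A => Φa (u.restrict A)
      empty' := by simp
      not_measurable' := fun A hA => by simp [SimpleFunc.restrict_of_not_measurable hA]
      m_iUnion' := by
        intro A hA hdisj
        -- `w` is `i + 1` on `A i` and `0` off the union.
        let w : T → ℕ := fun t => if h : ∃ i, t ∈ A i then Nat.find h + 1 else 0
        have hwA : ∀ i, ∀ t ∈ A i, w t = i + 1 := by
          intro i t ht
          have h : ∃ i, t ∈ A i := ⟨i, ht⟩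
          have : Nat.find h = i := by
            by_contra hne
            exact Set.disjoint_left.1 (hdisj hne) (Nat.find_spec h) ht
          simp only [w, dif_pos h, this]
        have hw : Measurable w := by
          refine measurable_to_countable' fun n => ?_
          rcases n with _ | n
          · have : w ⁻¹' {0} = (⋃ i, A i)ᶜ := by
              ext t
              simp only [mem_preimage, mem_singleton_iff, mem_compl_iff, mem_iUnion, w]
              split_ifs with h <;> simp [h]
            rw [this]
            exact (MeasurableSet.iUnion hA).compl
          · have : w ⁻¹' {n + 1} = A n := by
              ext t
              refine ⟨fun ht => ?_, fun ht => hwA n t ht⟩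
              by_cases h : ∃ i, t ∈ A i
              · obtain ⟨i, hi⟩ := h
                have h2 := hwA i t hi
                have h3 : w t = n + 1 := ht
                have : i = n := by omega
                exact this ▸ hi
              · have h3 : w t = n + 1 := ht
                simp [w, h] at h3
            rw [this]
            exact hA n
        have hfin : ∀ s : Finset ℕ, Φa (u.restrict (⋃ i, A i)) - ∑ i ∈ s, Φa (u.restrict (A i)) =
            Φa (u.restrict ((⋃ i, A i) \ ⋃ i ∈ s, A i)) := by
          intro s
          have hs : Φa (u.restrict (⋃ i ∈ s, A i)) = ∑ i ∈ s, Φa (u.restrict (A i)) := by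
            induction s using Finset.induction_on with
            | empty => simp
            | insert a s ha ih =>
              rw [Finset.set_biUnion_insert, Finset.sum_insert ha, restrict_union_of_disjoint u
                (hA a) (s.measurableSet_biUnion fun i _ => hA i), map_add, ih]
              refine Set.disjoint_iUnion₂_right.2 fun i hi => hdisj ?_
              rintro rfl
              exact ha hi
          have hsm : MeasurableSet (⋃ i ∈ s, A i) := s.measurableSet_biUnion fun i _ => hA i
          rw [← hs, sub_eq_iff_eq_add, ← map_add, ← restrict_union_of_disjoint u
            ((MeasurableSet.iUnion hA).diff hsm) hsm disjoint_sdiff_left]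
          rw [sdiff_union_of_subset (iUnion₂_subset fun i _ => subset_iUnion A i)]
        rw [HasSum, SummationFilter.unconditional_filter, Metric.tendsto_atTop]
        intro δ hδ
        obtain ⟨K, hK⟩ := habs hw (δ / 2) (half_pos hδ)
        refine ⟨Finset.range K, fun s hs => ?_⟩
        rw [dist_comm, Real.dist_eq, hfin]
        refine (hK _ ((MeasurableSet.iUnion hA).diff
          (s.measurableSet_biUnion fun i _ => hA i)) ?_).trans_lt (half_lt_self hδ)
        rintro t ⟨ht, hts⟩
        obtain ⟨i, hi⟩ := mem_iUnion.1 ht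
        rw [hwA i t hi]
        by_contra hlt
        exact hts (mem_iUnion₂.2 ⟨i, hs (Finset.mem_range.2 (by omega)), hi⟩) }
  have hac : ν ≪ᵥ μ.toENNRealVectorMeasure := by
    refine VectorMeasure.AbsolutelyContinuous.mk fun A hA h0 => ?_
    rw [Measure.toENNRealVectorMeasure_apply_measurable hA] at h0
    refine tendsto_nhds_unique (hlim (u.restrict A)) (tendsto_const_nhds.congr' ?_)
    filter_upwards [hUm] with Q hQ
    rw [restrict_restrict u hA hQ, hnull u _ (hA.inter hQ) (measure_mono_null inter_subset_left h0)]
  have hd := (SignedMeasure.absolutelyContinuous_iff_withDensityᵥ_rnDeriv_eq ν μ).1 hac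
  refine ⟨ν.rnDeriv μ, ν.measurable_rnDeriv μ, ν.integrable_rnDeriv μ, fun A hA => ?_⟩
  have : ν A = (μ.withDensityᵥ (ν.rnDeriv μ)) A := by rw [hd]
  rwa [withDensityᵥ_apply (ν.integrable_rnDeriv μ) hA] at this

end Density

/-! ### Splitting off the singular part -/

section Densities

variable {X : Type*} [AddCommGroup X] [Module ℝ X] {T : Type*} [MeasurableSpace T] {μ : Measure T}

/-- The densities in constant directions represent `Φa` on all simple functions. -/
theorem integrable_and_eq_integral_simpleFunc {Φa : SimpleFunc T X →ₗ[ℝ] ℝ} {ρ : X → T → ℝ}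
    (hint : ∀ y, Integrable (ρ y) μ)
    (hρ : ∀ y A, MeasurableSet A →
      Φa ((SimpleFunc.const T y).restrict A) = ∫ t in A, ρ y t ∂μ) (u : SimpleFunc T X) :
    Integrable (fun t => ρ (u t) t) μ ∧ Φa u = ∫ t, ρ (u t) t ∂μ := by
  classical
  have hset : ∀ s : Finset X, Φa (u.restrict (u ⁻¹' s)) =
      ∑ y ∈ s, ∫ t in u ⁻¹' {y}, ρ y t ∂μ := by
    intro s
    induction s using Finset.induction_on with
    | empty => simp
    | insert a s ha ih =>
      rw [Finset.sum_insert ha, Finset.coe_insert, insert_eq, preimage_union,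
        restrict_union_of_disjoint u (u.measurableSet_preimage _) (u.measurableSet_preimage _),
        map_add, ih]
      · congr 1
        rw [← hρ a _ (u.measurableSet_preimage _)]
        congr 1
        ext t
        rw [SimpleFunc.restrict_apply _ (u.measurableSet_preimage _),
          SimpleFunc.restrict_apply _ (u.measurableSet_preimage _)]
        by_cases ht : u t = a <;> simp [indicator, ht]
      · exact Disjoint.preimage _ (by simpa using ha)
  have hsum : (fun t => ρ (u t) t) =
      fun t => ∑ y ∈ u.range, (u ⁻¹' {y}).indicator (ρ y) t := by
    ext t
    rw [Finset.sum_eq_single_of_mem (u t) (u.mem_range_self t)]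
    · simp
    · intro y _ hy
      exact indicator_of_notMem (fun h => hy h.symm) _
  have hi : ∀ y ∈ u.range, Integrable ((u ⁻¹' {y}).indicator (ρ y)) μ := fun y _ =>
    (hint y).indicator (u.measurableSet_preimage _)
  rw [hsum]
  refine ⟨integrable_finsetSum _ hi, ?_⟩
  rw [integral_finsetSum _ hi]
  simp only [integral_indicator (u.measurableSet_preimage _)]
  rw [← hset u.range]
  congr 1
  have : u ⁻¹' (u.range : Set X) = univ := by
    rw [SimpleFunc.coe_range]
    exact preimage_range _
  rw [this, SimpleFunc.restrict_univ]

/-- The regular part `Λ` of `φ` has densities `ρ`, and its complement `φ - Λ` is bounded by `c` on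
the domain of the integral functional. The constant `c` is gained back in the domination of the
regular part. -/
theorem exists_densities [SigmaFinite μ] {k : T → X → EReal}
    (hconv : ∀ᵐ t ∂μ, IsConvexFun (k t))
    (habs : ∀ y, ∀ᶠ s in 𝓝[>] (0 : ℝ), ∃ g, IsIntegrableMajorant μ k (fun _ => s • y) g)
    {φ : X →ₗ[ℝ] ℝ} {α : ℝ}
    (hφ : ∀ y g, IsIntegrableMajorant μ k (fun _ => y) g → φ y ≤ ∫ t, g t ∂μ + α) :
    ∃ (ρ : X → T → ℝ) (Λ : X →ₗ[ℝ] ℝ) (c : ℝ),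
      (∀ y, Measurable (ρ y)) ∧ (∀ y, Integrable (ρ y) μ) ∧
      (∀ y z, ∀ᵐ t ∂μ, ρ (y + z) t = ρ y t + ρ z t) ∧
      (∀ y, Λ y = ∫ t, ρ y t ∂μ) ∧
      (∀ u : SimpleFunc T X, Integrable (fun t => ρ (u t) t) μ) ∧
      (∀ (u : SimpleFunc T X) g, IsIntegrableMajorant μ k u g →
        ∫ t, ρ (u t) t ∂μ + c ≤ ∫ t, g t ∂μ + α) ∧
      ∀ y g, IsIntegrableMajorant μ k (fun _ => y) g → φ y - Λ y ≤ c := by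
  classical
  obtain ⟨Φ, hΦφ, hΦ⟩ := exists_linear_extension_simpleFunc hconv habs hφ
  obtain ⟨g₀, hg₀⟩ : ∃ g, IsIntegrableMajorant μ k (fun _ => (0 : X)) g := by
    simpa using (habs 0).exists
  have hbdd := exists_bound_restrict habs hΦ
  obtain ⟨U, hUm, hUw, hUg⟩ := exists_exhausting_ultrafilter μ
  obtain ⟨Φa, hlim⟩ := exists_linear_ultrafilter_limit U
    (fun Q => Φ ∘ₗ restrictLinearMap X Q) hbdd
  replace hlim : ∀ u, Tendsto (fun Q => Φ (u.restrict Q)) U (𝓝 (Φa u)) := hlim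
  have hnull : ∀ u : SimpleFunc T X, ∀ A, MeasurableSet A → μ A = 0 → Φ (u.restrict A) = 0 := by
    intro u A hA h0
    -- All multiples of `u.restrict A` vanish almost everywhere, hence have the majorant `g₀`.
    have hle : ∀ s : ℝ, s * Φ (u.restrict A) ≤ ∫ t, g₀ t ∂μ + α := by
      intro s
      rw [← smul_eq_mul, ← map_smul]
      refine hΦ _ _ ⟨hg₀.1, ?_⟩
      filter_upwards [hg₀.2, measure_eq_zero_iff_ae_notMem.1 h0] with t ht htA
      simpa [SimpleFunc.restrict_apply _ hA, htA] using ht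
    by_contra hne
    have := hle ((∫ t, g₀ t ∂μ + α + 1) / Φ (u.restrict A))
    rw [div_mul_cancel₀ _ hne] at this
    linarith
  have hsplit : ∀ (u v : SimpleFunc T X) g g', IsIntegrableMajorant μ k u g →
      IsIntegrableMajorant μ k v g' → Φa u + (Φ v - Φa v) ≤ ∫ t, g t ∂μ + α := by
    intro u v g g' hu hv
    have h1 : Tendsto (fun Q => Φ (u.restrict Q) + (Φ v - Φ (v.restrict Q))) U
        (𝓝 (Φa u + (Φ v - Φa v))) := (hlim u).add (tendsto_const_nhds.sub (hlim v))
    have h2 : Tendsto (fun Q : Set T =>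
        ∫ t, g t ∂μ - ∫ t in Qᶜ, g t ∂μ + ∫ t in Qᶜ, g' t ∂μ + α) U
        (𝓝 (∫ t, g t ∂μ - 0 + 0 + α)) :=
      ((tendsto_const_nhds.sub (hUg g hu.1)).add (hUg g' hv.1)).add tendsto_const_nhds
    rw [sub_zero, add_zero] at h2
    refine le_of_tendsto_of_tendsto h1 h2 ?_
    filter_upwards [hUm] with Q hQ
    have hmaj := hu.piecewise hQ hv
    rw [← SimpleFunc.coe_piecewise hQ] at hmaj
    have hle := hΦ _ _ hmaj
    have hpw : SimpleFunc.piecewise Q hQ u v = u.restrict Q + (v - v.restrict Q) := by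
      ext t
      by_cases ht : t ∈ Q <;> simp [SimpleFunc.restrict_apply _ hQ, ht]
    rw [hpw, map_add, map_sub, integral_piecewise hQ hu.1.integrableOn hv.1.integrableOn] at hle
    have := integral_add_compl hQ hu.1
    linarith
  choose ρ hρm hρi hρ using fun y : X =>
    exists_density hbdd hUm hUw hlim hnull (SimpleFunc.const T y)
  have hsimple := integrable_and_eq_integral_simpleFunc hρi hρ
  let co : X →ₗ[ℝ] SimpleFunc T X :=
    { toFun := fun y => SimpleFunc.const T y, map_add' := fun _ _ => rfl,
      map_smul' := fun _ _ => rfl }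
  let C : Set ℝ := {r | ∃ y g, IsIntegrableMajorant μ k (fun _ => y) g ∧
    φ y - Φa (SimpleFunc.const T y) = r}
  have hC : ∀ (u : SimpleFunc T X) g, IsIntegrableMajorant μ k u g →
      ∀ r ∈ C, r ≤ ∫ t, g t ∂μ + α - Φa u := by
    rintro u g hu _ ⟨y, g', hy, rfl⟩
    have := hsplit u (SimpleFunc.const T y) g g' hu hy
    rw [hΦφ] at this
    linarith
  have hCne : C.Nonempty := ⟨_, 0, g₀, hg₀, rfl⟩
  refine ⟨ρ, Φa ∘ₗ co, sSup C, hρm, hρi, fun y z => ?_, fun y => ?_,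
    fun u => (hsimple u).1, fun u g hu => ?_, fun y g hy => ?_⟩
  · refine (hρi (y + z)).ae_eq_of_forall_setIntegral_eq _ (fun t => ρ y t + ρ z t)
      ((hρi y).add (hρi z)) fun A hA _ => ?_
    rw [integral_add (hρi y).integrableOn (hρi z).integrableOn, ← hρ _ _ hA, ← hρ _ _ hA,
      ← hρ _ _ hA, ← map_add]
    exact congrArg Φa (map_add (restrictLinearMap X A) (co y) (co z))
  · exact (hsimple (SimpleFunc.const T y)).2
  · rw [← (hsimple u).2]
    linarith [csSup_le hCne (hC u g hu)]
  · exact le_csSup ⟨_, hC (SimpleFunc.const T 0) g₀ hg₀⟩ ⟨y, g, hy, rfl⟩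

end Densities

/-! ### From integrated to pointwise domination -/

section Conjugate

open scoped ENNReal NNReal

variable {X : Type*} {T : Type*} [MeasurableSpace T] {μ : Measure T}

theorem exists_simpleFunc_maximizing [Zero X] {h : X → T → ℝ≥0∞} (hmeas : ∀ y, Measurable (h y))
    (F : Finset X) :
    ∃ u : SimpleFunc T X, ∀ t, F.sup (fun y => h y t) ≤ h (u t) t := by
  classical
  induction F using Finset.induction_on with
  | empty => exact ⟨SimpleFunc.const T 0, fun t => by simp⟩
  | insert a F _ ih =>
    obtain ⟨u, hu⟩ := ih
    have hA : MeasurableSet {t | h (u t) t < h a t} :=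
      measurableSet_lt (u.measurable_bind h hmeas) (hmeas a)
    refine ⟨SimpleFunc.piecewise _ hA (SimpleFunc.const T a) u, fun t => ?_⟩
    rw [Finset.sup_insert]
    by_cases ht : h (u t) t < h a t
    · simpa [ht] using (hu t).trans ht.le
    · simpa [ht] using ⟨not_lt.1 ht, Finset.sup_le_iff.1 (hu t)⟩

/-- The integrated domination of the densities becomes a pointwise one: `b t` bounds the conjugate
of `k t` at the functional `y ↦ ρ y t`, and the integral of `b` obeys the bound of the conjugate
integral functional. -/
theorem exists_integrable_gap [AddCommGroup X] [SigmaFinite μ] {k : T → X → EReal}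
    (hmeas : ∀ y, Measurable fun t => k t y) (hbot : ∀ y, ∀ᵐ t ∂μ, ⊥ < k t y)
    (h₀ : ∃ g, IsIntegrableMajorant μ k (fun _ => (0 : X)) g)
    {ρ : X → T → ℝ} {c α : ℝ} (hρm : ∀ y, Measurable (ρ y))
    (hadd : ∀ y z, ∀ᵐ t ∂μ, ρ (y + z) t = ρ y t + ρ z t)
    (hint : ∀ u : SimpleFunc T X, Integrable (fun t => ρ (u t) t) μ)
    (hle : ∀ (u : SimpleFunc T X) g, IsIntegrableMajorant μ k u g →
      ∫ t, ρ (u t) t ∂μ + c ≤ ∫ t, g t ∂μ + α) :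
    ∃ b : T → ℝ, Integrable b μ ∧ ∫ t, b t ∂μ + c ≤ α ∧
      ∀ y, ∀ᵐ t ∂μ, ((ρ y t - b t : ℝ) : EReal) ≤ k t y := by
  classical
  obtain ⟨g₀, hg₀i, hg₀⟩ := h₀
  let κ₀ : T → ℝ := fun t => (k t 0).toReal
  have hκ₀m : Measurable κ₀ := (hmeas 0).ereal_toReal
  have hκ₀ : ∀ᵐ t ∂μ, k t 0 = (κ₀ t : EReal) := by
    filter_upwards [hg₀, hbot 0] with t h1 h2
    exact (EReal.coe_toReal (ne_top_of_le_ne_top (EReal.coe_ne_top _) h1) h2.ne').symm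
  have hκ₀i : Integrable κ₀ μ := by
    refine integrable_of_integrable_majorants (c := ∫ t, ρ 0 t ∂μ + c - α)
      hκ₀m.aestronglyMeasurable hg₀i ?_ ?_
    · filter_upwards [hκ₀, hg₀] with t h1 h2
      rwa [h1, EReal.coe_le_coe_iff] at h2
    · intro g hg hκg
      have := hle (SimpleFunc.const T 0) g ⟨hg, ?_⟩
      · simp only [SimpleFunc.const_apply] at this
        linarith
      · filter_upwards [hκ₀, hκg] with t h1 h2
        simpa [h1] using h2
  have hρ0 : ∀ᵐ t ∂μ, ρ 0 t = 0 := by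
    filter_upwards [hadd 0 0] with t ht
    simpa using ht
  have hρ0i : ∫ t, ρ 0 t ∂μ = 0 := integral_eq_zero_of_ae hρ0
  let h : X → T → ℝ≥0∞ := fun y t =>
    if k t y < ⊤ then ENNReal.ofReal (ρ y t + κ₀ t - (k t y).toReal) else 0
  have hhm : ∀ y, Measurable (h y) := fun y =>
    Measurable.ite (measurableSet_lt (hmeas y) measurable_const)
      (((hρm y).add hκ₀m).sub (hmeas y).ereal_toReal).ennreal_ofReal measurable_const
  have hhtop : ∀ y t, h y t ≠ ∞ := by
    intro y t
    simp only [h]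
    split_ifs <;> simp
  have hβ : 0 ≤ ∫ t, κ₀ t ∂μ + α - c := by
    have := hle (SimpleFunc.const T 0) κ₀ ⟨hκ₀i, by
      filter_upwards [hκ₀] with t ht using by simp [ht]⟩
    simp only [SimpleFunc.const_apply, hρ0i] at this
    linarith
  obtain ⟨b, hbm, hbK, hb⟩ := exists_measurable_ae_upper_bound (μ := μ) (h := h)
    (K := ENNReal.ofReal (∫ t, κ₀ t ∂μ + α - c)) hhm ENNReal.ofReal_ne_top (by
      intro F
      obtain ⟨u, hu⟩ := exists_simpleFunc_maximizing hhm F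
      refine (lintegral_mono hu).trans ?_
      have := lintegral_le_ofReal_of_integrable_minorants (μ := μ)
        (w := fun t => (h (u t) t).toNNReal) (β := ∫ t, κ₀ t ∂μ + α - c) ?_
      · simpa only [ENNReal.coe_toNNReal (hhtop _ _)] using this
      intro κ hκ hκ0 hκw
      -- Where the gap vanishes the value `0` is used, so that the integrand is dominated there.
      have hA : MeasurableSet {t | h (u t) t = 0} :=
        (u.measurable_bind h hhm) (measurableSet_singleton 0)
      let v : SimpleFunc T X := SimpleFunc.piecewise _ hA (SimpleFunc.const T 0) u
      have hmaj : IsIntegrableMajorant μ k v fun t => ρ (v t) t + κ₀ t - κ t := by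
        refine ⟨((hint v).add hκ₀i).sub hκ, ?_⟩
        have hbot' : ∀ᵐ t ∂μ, ∀ y ∈ u.range, ⊥ < k t y :=
          (ae_ball_iff u.range.countable_toSet).2 fun y _ => hbot y
        filter_upwards [hκ₀, hρ0, hbot'] with t h1 h2 h3
        have hκt := hκw t
        by_cases ht : h (u t) t = 0
        · have hv : v t = 0 := by simp [v, ht]
          have hκ0' : κ t = 0 := le_antisymm (by simpa [ht] using hκt) (hκ0 t)
          simp [hv, h1, h2, hκ0']
        · have hv : v t = u t := by simp [v, ht]
          have hlt : k t (u t) < ⊤ := by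
            by_contra hcon
            exact ht (by simp only [h, if_neg hcon])
          have hw : h (u t) t = ENNReal.ofReal (ρ (u t) t + κ₀ t - (k t (u t)).toReal) := by
            simp only [h, if_pos hlt]
          have hpos : 0 < ρ (u t) t + κ₀ t - (k t (u t)).toReal := by
            rw [hw] at ht
            exact ENNReal.ofReal_pos.1 (pos_iff_ne_zero.2 ht)
          rw [hw, ENNReal.coe_toNNReal_eq_toReal, ENNReal.toReal_ofReal hpos.le] at hκt
          rw [hv, ← EReal.coe_toReal hlt.ne (h3 _ (u.mem_range_self t)).ne']
          exact EReal.coe_le_coe_iff.2 (by linarith)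
      have := hle v _ hmaj
      have hI := integral_sub ((hint v).add hκ₀i) hκ
      have hI' := integral_add (hint v) hκ₀i
      simp only [Pi.add_apply] at hI
      linarith)
  have hbtop : ∫⁻ t, b t ∂μ ≠ ∞ := ne_top_of_le_ne_top ENNReal.ofReal_ne_top hbK
  have hbi : Integrable (fun t => (b t).toReal) μ :=
    integrable_toReal_of_lintegral_ne_top hbm.aemeasurable hbtop
  refine ⟨fun t => (b t).toReal - κ₀ t, hbi.sub hκ₀i, ?_, fun y => ?_⟩
  · rw [integral_sub hbi hκ₀i, integral_toReal hbm.aemeasurable (ae_lt_top hbm hbtop)]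
    have := ENNReal.toReal_mono ENNReal.ofReal_ne_top hbK
    rw [ENNReal.toReal_ofReal hβ] at this
    linarith
  · filter_upwards [hb y, hbot y, ae_lt_top hbm hbtop] with t h1 h2 h3
    by_cases ht : k t y < ⊤
    · rw [← EReal.coe_toReal ht.ne h2.ne', EReal.coe_le_coe_iff]
      simp only [h, if_pos ht] at h1
      have := (ENNReal.ofReal_le_iff_le_toReal h3.ne).1 h1
      linarith
    · rw [not_lt_top_iff.1 ht]
      exact le_top

end Conjugate

/-! ### Weak-star measurable selections -/

section Selection

variable {X : Type*} [AddCommGroup X] [Module ℝ X] [TopologicalSpace X] [IsTopologicalAddGroup X]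
  [ContinuousSMul ℝ X]

/-- An affine minorant on a dense set is a minorant everywhere. The function need not be lower
semicontinuous: a neighbourhood on which it is bounded is moved towards `y` by homotheties. -/
theorem IsConvexFun.le_of_le_on_dense {h : X → EReal} (hh : IsConvexFun h) {z : X} {N : ℝ}
    (hz : ∀ᶠ y in 𝓝 z, h y ≤ (N : EReal)) (m : X →L[ℝ] ℝ) (β : ℝ) {D : Set X} (hD : Dense D)
    (hmD : ∀ d ∈ D, ((m d - β : ℝ) : EReal) ≤ h d) (y : X) : ((m y - β : ℝ) : EReal) ≤ h y := by
  refine EReal.le_of_forall_lt_iff_le.1 fun r hr => ?_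
  rw [EReal.coe_le_coe_iff]
  have key : ∀ s : ℝ, 0 < s → s < 1 →
      m ((1 - s) • y + s • z) - β ≤ (1 - s) * r + s * N := by
    intro s hs hs1
    by_contra hcon
    push Not at hcon
    set p := (1 - s) • y + s • z with hp
    have h1 : ∀ᶠ q in 𝓝 p, (1 - s) * r + s * N < m q - β :=
      (m.continuous.sub continuous_const).continuousAt.eventually (lt_mem_nhds hcon)
    -- The homothety with centre `y` that carries `z` to `p` carries a neighbourhood of `z`
    -- to a neighbourhood of `p`.
    have h2 : Tendsto (fun q => z + s⁻¹ • (q - p)) (𝓝 p) (𝓝 z) := by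
      have : Continuous fun q => z + s⁻¹ • (q - p) := by fun_prop
      simpa using this.tendsto p
    obtain ⟨q, hqD, hq1, hq2⟩ := hD.inter_nhds_nonempty (h1.and (h2.eventually hz))
    have hq : (1 - s) • y + s • (z + s⁻¹ • (q - p)) = q := by
      rw [smul_add, smul_inv_smul₀ hs.ne', hp]
      abel
    have hle := hh.le_of_le hr.le hq2 (sub_nonneg.2 hs1.le) hs.le (by ring)
    rw [hq] at hle
    have := EReal.coe_le_coe_iff.1 ((hmD q hqD).trans hle)
    linarith
  have hl : Tendsto (fun s : ℝ => m ((1 - s) • y + s • z) - β) (𝓝[>] 0) (𝓝 (m y - β)) := by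
    have : Continuous fun s : ℝ => m ((1 - s) • y + s • z) - β := by fun_prop
    simpa using (this.tendsto 0).mono_left nhdsWithin_le_nhds
  have hr' : Tendsto (fun s : ℝ => (1 - s) * r + s * N) (𝓝[>] 0) (𝓝 r) := by
    have : Continuous fun s : ℝ => (1 - s) * r + s * N := by fun_prop
    simpa using (this.tendsto 0).mono_left nhdsWithin_le_nhds
  refine le_of_tendsto_of_tendsto hl hr' ?_
  filter_upwards [self_mem_nhdsWithin, nhdsWithin_le_nhds (gt_mem_nhds zero_lt_one)] with s h1 h2
  exact key s h1 h2

variable {T : Type*} [MeasurableSpace T] {μ : Measure T}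

/-- For almost every `t` the densities `ρ y t` with `y` in a dense subgroup `D` come from a
continuous linear functional. The hypothesis `hDae` allows the null sets to be united over `D`. -/
theorem exists_selection_on_dense {k : T → X → EReal}
    (hbd : ∀ᵐ t ∂μ, ∃ (z : X) (N : ℝ), ∀ᶠ y in 𝓝 z, k t y ≤ (N : EReal))
    {ρ : X → T → ℝ} {b : T → ℝ} (hadd : ∀ y z, ∀ᵐ t ∂μ, ρ (y + z) t = ρ y t + ρ z t)
    (hρb : ∀ y, ∀ᵐ t ∂μ, ((ρ y t - b t : ℝ) : EReal) ≤ k t y)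
    {D : AddSubgroup X} (hD : Dense (D : Set X))
    (hDae : ∀ P : X → T → Prop, (∀ y ∈ D, ∀ᵐ t ∂μ, P y t) → ∀ᵐ t ∂μ, ∀ y ∈ D, P y t) :
    ∃ m : T → X →L[ℝ] ℝ, ∀ᵐ t ∂μ, ∀ y ∈ D, m t y = ρ y t := by
  have hadd' : ∀ᵐ t ∂μ, ∀ y ∈ D, ∀ z ∈ D, ρ (y + z) t = ρ y t + ρ z t :=
    hDae _ fun y _ => hDae _ fun z _ => hadd y z
  have hex : ∀ᵐ t ∂μ, ∃ m : X →L[ℝ] ℝ, ∀ y ∈ D, m y = ρ y t := by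
    filter_upwards [hadd', hDae _ fun y _ => hρb y, hbd] with t h1 h2 ⟨z, N, hzN⟩
    let r : D →+ ℝ := AddMonoidHom.mk' (fun d => ρ d t) fun d e => h1 d d.2 e e.2
    obtain ⟨d, hd, hdN⟩ := hD.inter_nhds_nonempty hzN.eventually_nhds
    have hr : Continuous r := by
      refine continuous_of_bddAbove_near r (g := ⟨d, hd⟩) (N := N + b t) ?_
      have : ∀ᶠ e : D in 𝓝 ⟨d, hd⟩, k t e ≤ (N : EReal) :=
        (continuous_subtype_val.tendsto (⟨d, hd⟩ : D)).eventually hdN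
      filter_upwards [this] with e he
      have := EReal.coe_le_coe_iff.1 ((h2 e e.2).trans he)
      change ρ e t ≤ N + b t
      linarith
    obtain ⟨m, hm⟩ := exists_continuousLinearMap_extension hD r hr
    exact ⟨m, fun y hy => hm ⟨y, hy⟩⟩
  choose! m hm using fun (t : T) (h : ∃ m : X →L[ℝ] ℝ, ∀ y ∈ D, m y = ρ y t) => h
  exact ⟨m, hex.mono hm⟩

/-- The densities are the values of one weak-star measurable selection `m`, for each `y` up to a
null set depending on `y`, while the affine minorization holds for almost every `t` at all `y` at
once. -/
theorem exists_selection (hXT : TopologicalSpace.SeparableSpace X ∨ Countable T)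
    {k : T → X → EReal} (hconv : ∀ᵐ t ∂μ, IsConvexFun (k t))
    (hbd : ∀ᵐ t ∂μ, ∃ (z : X) (N : ℝ), ∀ᶠ y in 𝓝 z, k t y ≤ (N : EReal))
    {ρ : X → T → ℝ} {b : T → ℝ} (hadd : ∀ y z, ∀ᵐ t ∂μ, ρ (y + z) t = ρ y t + ρ z t)
    (hρb : ∀ y, ∀ᵐ t ∂μ, ((ρ y t - b t : ℝ) : EReal) ≤ k t y) :
    ∃ m : T → X →L[ℝ] ℝ, (∀ y, ∀ᵐ t ∂μ, m t y = ρ y t) ∧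
      ∀ᵐ t ∂μ, ∀ y, ((m t y - b t : ℝ) : EReal) ≤ k t y := by
  rcases hXT with hX | hT
  · have hspan : ∀ s : Set X, s.Countable →
        ((Submodule.span ℤ s : Submodule ℤ X) : Set X).Countable := by
      intro s hs
      have := hs.to_subtype
      rw [← Subtype.range_coe (s := s), ← Finsupp.range_linearCombination]
      exact countable_range _
    have hae : ∀ s : Set X, s.Countable → ∀ P : X → T → Prop,
        (∀ y ∈ (Submodule.span ℤ s).toAddSubgroup, ∀ᵐ t ∂μ, P y t) →
        ∀ᵐ t ∂μ, ∀ y ∈ (Submodule.span ℤ s).toAddSubgroup, P y t := fun s hs P hP =>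
      (ae_ball_iff (hspan s hs)).2 hP
    obtain ⟨s, hs, hsd⟩ := TopologicalSpace.exists_countable_dense X
    have hD : Dense ((Submodule.span ℤ s).toAddSubgroup : Set X) := hsd.mono Submodule.subset_span
    obtain ⟨m, hm⟩ := exists_selection_on_dense hbd hadd hρb hD (hae s hs)
    refine ⟨m, fun x => ?_, ?_⟩
    · -- The same construction on the group generated by `s` and `x` gives the same functional.
      have hsub : Submodule.span ℤ s ≤ Submodule.span ℤ (insert x s) :=
        Submodule.span_mono (subset_insert _ _)
      obtain ⟨m', hm'⟩ := exists_selection_on_dense hbd hadd hρb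
        (D := (Submodule.span ℤ (insert x s)).toAddSubgroup) (hD.mono hsub)
        (hae _ (hs.insert x))
      filter_upwards [hm, hm'] with t h1 h2
      have heq : (m t : X → ℝ) = m' t := Continuous.ext_on hD (m t).continuous (m' t).continuous
        fun d hd => (h1 d hd).trans (h2 d (hsub hd)).symm
      rw [heq]
      exact h2 x (Submodule.subset_span (mem_insert _ _))
    · filter_upwards [hm, hae s hs _ fun y _ => hρb y, hconv, hbd] with t h1 h2 h3 ⟨z, N, h4⟩
      exact h3.le_of_le_on_dense h4 (m t) (b t) hD fun d hd => by rw [h1 d hd]; exact h2 d hd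
  · have hae : ∀ P : X → T → Prop, (∀ y ∈ (⊤ : AddSubgroup X), ∀ᵐ t ∂μ, P y t) →
        ∀ᵐ t ∂μ, ∀ y ∈ (⊤ : AddSubgroup X), P y t := by
      intro P hP
      rw [ae_iff_of_countable]
      exact fun t ht y hy => ae_iff_of_countable.1 (hP y hy) t ht
    obtain ⟨m, hm⟩ := exists_selection_on_dense (D := ⊤) hbd hadd hρb (by simp) hae
    refine ⟨m, fun y => hm.mono fun t ht => ht y trivial, ?_⟩
    filter_upwards [hm, hae _ fun y _ => hρb y] with t h1 h2 y
    rw [h1 y trivial]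
    exact h2 y trivial

end Selection

/-! ### Integral functions -/

section UpperIntegral

variable {X : Type*} {T : Type*} [MeasurableSpace T] {μ : Measure T} {f : T → X → EReal}

theorem integralFun_le {y : X} {g : T → ℝ} (hg : IsIntegrableMajorant μ f (fun _ => y) g) :
    integralFun μ f y ≤ ((∫ t, g t ∂μ : ℝ) : EReal) :=
  sInf_le ⟨g, hg.1, hg.2, rfl⟩

theorem exists_majorant_of_integralFun_lt {y : X} {a : EReal} (h : integralFun μ f y < a) :
    ∃ g, IsIntegrableMajorant μ f (fun _ => y) g ∧ ((∫ t, g t ∂μ : ℝ) : EReal) < a := by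
  obtain ⟨_, ⟨g, hg, hle, rfl⟩, hlt⟩ := sInf_lt_iff.1 h
  exact ⟨g, ⟨hg, hle⟩, hlt⟩

theorem le_integralFun {y : X} {c : ℝ}
    (h : ∀ g, IsIntegrableMajorant μ f (fun _ => y) g → c ≤ ∫ t, g t ∂μ) :
    (c : EReal) ≤ integralFun μ f y := by
  refine le_sInf ?_
  rintro _ ⟨g, hg, hle, rfl⟩
  exact EReal.coe_le_coe_iff.2 (h g ⟨hg, hle⟩)

/-- Where the upper integral is finite it is the integral of a real-valued integrable function. -/
theorem integralFun_eq_integral [SigmaFinite μ] {y : X} (hmeas : Measurable fun t => f t y)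
    (hbot : ∀ᵐ t ∂μ, ⊥ < f t y) (hlow : ⊥ < integralFun μ f y) (hup : integralFun μ f y < ⊤) :
    Integrable (fun t => (f t y).toReal) μ ∧ (∀ᵐ t ∂μ, f t y = ((f t y).toReal : EReal)) ∧
      integralFun μ f y = ((∫ t, (f t y).toReal ∂μ : ℝ) : EReal) := by
  obtain ⟨g₀, hg₀, -⟩ := exists_majorant_of_integralFun_lt hup
  have heq : ∀ᵐ t ∂μ, f t y = ((f t y).toReal : EReal) := by
    filter_upwards [hg₀.2, hbot] with t h1 h2
    exact (EReal.coe_toReal (ne_top_of_le_ne_top (EReal.coe_ne_top _) h1) h2.ne').symm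
  have hmaj : ∀ g : T → ℝ, (∀ᵐ t ∂μ, f t y ≤ (g t : EReal)) ↔ ∀ᵐ t ∂μ, (f t y).toReal ≤ g t := by
    intro g
    refine eventually_congr ?_
    filter_upwards [heq] with t ht
    conv_lhs => rw [ht]
    exact EReal.coe_le_coe_iff
  have hint : Integrable (fun t => (f t y).toReal) μ := by
    refine integrable_of_integrable_majorants (c := (integralFun μ f y).toReal)
      hmeas.ereal_toReal.aestronglyMeasurable hg₀.1 ((hmaj _).1 hg₀.2) fun g hg hle => ?_
    have := integralFun_le ⟨hg, (hmaj g).2 hle⟩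
    rwa [← EReal.coe_toReal hup.ne hlow.ne', EReal.coe_le_coe_iff] at this
  refine ⟨hint, heq, le_antisymm (integralFun_le ⟨hint, (hmaj _).2 (ae_of_all _ fun _ => le_rfl)⟩)
    (le_integralFun fun g hg => integral_mono_ae hint hg.1 ((hmaj g).1 hg.2))⟩

variable [AddCommGroup X] [Module ℝ X] [TopologicalSpace X] [IsTopologicalAddGroup X]
  [ContinuousSMul ℝ X]

/-- A convex function that is finite and continuous at one point is nowhere `-∞`. -/
theorem bot_lt_integralFun (hconv : ∀ᵐ t ∂μ, IsConvexFun (f t)) {x₀ : X}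
    (hx₀ : IsContinuityPoint (integralFun μ f) x₀) (x : X) : ⊥ < integralFun μ f x := by
  obtain ⟨hlow, hup, hcont⟩ := hx₀
  -- `x₀` lies strictly between `x` and some point `x₀ + s • (x₀ - x)` of the domain.
  have hlim : Tendsto (fun s : ℝ => x₀ + s • (x₀ - x)) (𝓝[>] 0) (𝓝 x₀) := by
    have : Continuous fun s : ℝ => x₀ + s • (x₀ - x) := by fun_prop
    simpa using (this.tendsto 0).mono_left nhdsWithin_le_nhds
  obtain ⟨s, hs1, hs⟩ := ((hlim.eventually (hcont.eventually (gt_mem_nhds hup))).and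
    self_mem_nhdsWithin).exists
  have hs : 0 < s := hs
  obtain ⟨g₁, hg₁, -⟩ := exists_majorant_of_integralFun_lt hs1
  obtain ⟨r, -, hr⟩ := EReal.lt_iff_exists_real_btwn.1 hlow
  refine lt_of_lt_of_le (EReal.bot_lt_coe (((1 + s) * r - ∫ t, g₁ t ∂μ) / s))
    (le_integralFun fun g hg => ?_)
  rw [div_le_iff₀ hs]
  have hmaj : IsIntegrableMajorant μ f (fun _ => x₀)
      fun t => (1 + s)⁻¹ * g₁ t + s / (1 + s) * g t := by
    refine ⟨(hg₁.1.const_mul _).add (hg.1.const_mul _), ?_⟩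
    filter_upwards [hconv, hg₁.2, hg.2] with t h h1 h2
    have hcomb : (1 + s)⁻¹ • (x₀ + s • (x₀ - x)) + (s / (1 + s)) • x = x₀ := by
      match_scalars <;> field_simp
      ring
    rw [← hcomb]
    exact h.le_of_le h1 h2 (by positivity) (by positivity) (by field_simp)
  have := EReal.coe_le_coe_iff.1 (hr.le.trans (integralFun_le hmaj))
  rw [integral_add (hg₁.1.const_mul _) (hg.1.const_mul _), integral_const_mul,
    integral_const_mul, inv_mul_eq_div, div_mul_eq_mul_div, ← add_div,
    le_div_iff₀ (by positivity)] at this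
  linarith

end UpperIntegral

/-! ### The subdifferential of the integral function -/

section Subdifferential

variable {X : Type*} [AddCommGroup X] [Module ℝ X] [TopologicalSpace X]

theorem mem_epsNormal_iff {A : Set X} {ε : ℝ} {x : X} {φ : X →L[ℝ] ℝ} :
    φ ∈ epsNormal A ε x ↔ x ∈ A ∧ ∀ y ∈ A, φ (y - x) ≤ ε := by
  constructor
  · rintro ⟨-, h2, h3⟩
    have hx : x ∈ A := by
      by_contra hx
      simp [indicatorFun, hx] at h2
    refine ⟨hx, fun y hy => ?_⟩
    have := h3 y
    simpa [indicatorFun, hx, hy, -map_sub] using this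
  · rintro ⟨hx, h⟩
    refine ⟨by simp [indicatorFun, hx], by simp [indicatorFun, hx], fun y => ?_⟩
    by_cases hy : y ∈ A
    · simpa [indicatorFun, hx, hy, -map_sub] using h y hy
    · simp [indicatorFun, hx, hy]

/-- The defining inequality without extended-real subtraction. -/
theorem mem_epsSubdiff_iff_of_eq_coe {h : X → EReal} {ε r : ℝ} {x : X} {φ : X →L[ℝ] ℝ}
    (hr : h x = (r : EReal)) :
    φ ∈ epsSubdiff h ε x ↔ ∀ y, ((φ (y - x) + r - ε : ℝ) : EReal) ≤ h y := by
  have key : ∀ y, ((φ (y - x) : ℝ) : EReal) ≤ h y - h x + (ε : EReal) ↔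
      ((φ (y - x) + r - ε : ℝ) : EReal) ≤ h y := by
    intro y
    rw [hr]
    induction h y with
    | bot =>
      rw [EReal.bot_sub, EReal.bot_add]
      exact iff_of_false (fun h => EReal.coe_ne_bot _ (le_bot_iff.1 h))
        fun h => EReal.coe_ne_bot _ (le_bot_iff.1 h)
    | top => simp
    | coe a =>
      rw [← EReal.coe_sub, ← EReal.coe_add, EReal.coe_le_coe_iff, EReal.coe_le_coe_iff]
      constructor <;> intro h <;> linarith
  simp only [epsSubdiff, mem_ofPred_eq, key]
  simp [hr]

variable {T : Type*} [MeasurableSpace T] {μ : Measure T} {f : T → X → EReal}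

theorem IsConvexNormalIntegrand.measurable_apply (hf : IsConvexNormalIntegrand μ f) (y : X) :
    Measurable fun t => f t y := by
  let _ : MeasurableSpace X := borel X
  exact hf.1.comp (measurable_prodMk_right (y := y))

variable [IsTopologicalAddGroup X] [ContinuousSMul ℝ X] [SigmaFinite μ]

/-- The inclusion of the decomposed set in the `ε`-subdifferential of the integral function. -/
theorem add_mem_epsSubdiff_integralFun (hf : IsConvexNormalIntegrand μ f) {x₀ : X}
    (hx₀ : IsContinuityPoint (integralFun μ f) x₀) {x : X} {ε₁ ε₂ : ℝ} {l : T → ℝ}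
    (hl : l ∈ nonnegIntegrableLE μ ε₁) {φ₁ φ₂ : X →L[ℝ] ℝ}
    (hφ₁ : φ₁ ∈ weakIntegral μ fun t => epsSubdiff (f t) (l t) x)
    (hφ₂ : φ₂ ∈ epsNormal (effDom (integralFun μ f)) ε₂ x) :
    φ₁ + φ₂ ∈ epsSubdiff (integralFun μ f) (ε₁ + ε₂) x := by
  obtain ⟨hx, hφ₂⟩ := mem_epsNormal_iff.1 hφ₂
  have hlow := bot_lt_integralFun (hf.2.mono fun t ht => ht.2.1) hx₀
  have hfin : ∀ y, integralFun μ f y < ⊤ → _ := fun y hy => integralFun_eq_integral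
    (hf.measurable_apply y) (hf.2.mono fun t ht => ht.2.2.2 y) (hlow y) hy
  obtain ⟨hxi, hxe, hxI⟩ := hfin x hx
  rw [mem_epsSubdiff_iff_of_eq_coe hxI]
  intro y
  by_cases hy : integralFun μ f y < ⊤
  · obtain ⟨hyi, hye, hyI⟩ := hfin y hy
    rw [hyI, EReal.coe_le_coe_iff]
    obtain ⟨m, hmi, hm, hφ₁⟩ := hφ₁
    have hle : φ₁ (y - x) ≤
        ∫ t, (f t y).toReal ∂μ - ∫ t, (f t x).toReal ∂μ + ∫ t, l t ∂μ := by
      have hd : Integrable (fun t => (f t y).toReal - (f t x).toReal) μ := hyi.sub hxi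
      rw [hφ₁, ← integral_sub hyi hxi, ← integral_add hd hl.1]
      refine integral_mono_ae (hmi _) (hd.add hl.1) ?_
      filter_upwards [hm, hxe, hye] with t h1 h2 h3
      have := (mem_epsSubdiff_iff_of_eq_coe h2).1 h1 y
      rw [h3, EReal.coe_le_coe_iff] at this
      change m t (y - x) ≤ (f t y).toReal - (f t x).toReal + l t
      linarith
    have := hφ₂ y hy
    have := hl.2.2
    simp only [_root_.add_apply]
    linarith
  · rw [not_lt_top_iff.1 hy]
    exact le_top

/-- Every `ε`-subgradient of the integral function splits into a weak integral of approximate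
subgradients and an approximate normal to the domain. -/
theorem exists_decomposition_of_mem_epsSubdiff (hf : IsConvexNormalIntegrand μ f)
    (hXT : TopologicalSpace.SeparableSpace X ∨ Countable T) {x₀ : X}
    (hx₀ : IsContinuityPoint (integralFun μ f) x₀)
    (hft : ∀ᵐ t ∂μ, ∃ z, IsContinuityPoint (f t) z) {x : X} {ε : ℝ} {φ : X →L[ℝ] ℝ}
    (hφ : φ ∈ epsSubdiff (integralFun μ f) ε x) :
    ∃ l : T → ℝ, Integrable l μ ∧ (∀ t, 0 ≤ l t) ∧ ∫ t, l t ∂μ ≤ ε ∧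
      ∃ φ₁ ∈ weakIntegral μ fun t => epsSubdiff (f t) (l t) x,
        φ - φ₁ ∈ epsNormal (effDom (integralFun μ f)) (ε - ∫ t, l t ∂μ) x := by
  obtain ⟨hxi, hxe, hxI⟩ := integralFun_eq_integral (hf.measurable_apply x)
    (hf.2.mono fun t ht => ht.2.2.2 x) hφ.1 hφ.2.1
  have hxdom : x ∈ effDom (integralFun μ f) := hφ.2.1
  rw [mem_epsSubdiff_iff_of_eq_coe hxI] at hφ
  set r := ∫ t, (f t x).toReal ∂μ with hr
  let k : T → X → EReal := fun t y => f t (x₀ + y)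
  have hconv : ∀ᵐ t ∂μ, IsConvexFun (k t) := by
    filter_upwards [hf.2] with t ht
    rintro ⟨y, a⟩ hy ⟨z, b⟩ hz p q hp hq hpq
    have := ht.2.1.le_of_le hy hz hp hq hpq
    have hcomb : p • (x₀ + y) + q • (x₀ + z) = x₀ + (p • y + q • z) := by
      rw [smul_add, smul_add, add_add_add_comm, ← add_smul, hpq, one_smul]
    rwa [hcomb] at this
  have hlimx₀ : Tendsto (fun y => x₀ + y) (𝓝 0) (𝓝 x₀) := by
    simpa using (continuous_const_add x₀).tendsto 0
  have habs : ∀ y, ∀ᶠ s in 𝓝[>] (0 : ℝ), ∃ g, IsIntegrableMajorant μ k (fun _ => s • y) g := by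
    intro y
    have hs : Tendsto (fun s : ℝ => s • y) (𝓝[>] 0) (𝓝 0) := by
      have : Continuous fun s : ℝ => s • y := by fun_prop
      simpa using (this.tendsto 0).mono_left nhdsWithin_le_nhds
    filter_upwards [(hlimx₀.comp hs).eventually (hx₀.2.2.eventually (gt_mem_nhds hx₀.2.1))]
      with s hs
    obtain ⟨g, hg, -⟩ := exists_majorant_of_integralFun_lt hs
    exact ⟨g, hg⟩
  have hφk : ∀ y g, IsIntegrableMajorant μ k (fun _ => y) g →
      (φ : X →ₗ[ℝ] ℝ) y ≤ ∫ t, g t ∂μ + (ε - r + φ (x - x₀)) := by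
    intro y g hg
    have h1 := EReal.coe_le_coe_iff.1 ((hφ (x₀ + y)).trans (integralFun_le (f := f) hg))
    simp only [ContinuousLinearMap.coe_coe, map_sub, map_add] at h1 ⊢
    linarith
  have hbd : ∀ᵐ t ∂μ, ∃ (z : X) (N : ℝ), ∀ᶠ y in 𝓝 z, k t y ≤ (N : EReal) := by
    filter_upwards [hft] with t ⟨z, hz1, hz2, hz3⟩
    obtain ⟨N, hN, -⟩ := EReal.lt_iff_exists_real_btwn.1 hz2
    refine ⟨z - x₀, N, ?_⟩
    have : Tendsto (fun y => x₀ + y) (𝓝 (z - x₀)) (𝓝 z) := by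
      simpa using (continuous_const_add x₀).tendsto (z - x₀)
    filter_upwards [this.eventually (hz3.eventually (gt_mem_nhds hN))] with y hy using hy.le
  have h₀ : ∃ g, IsIntegrableMajorant μ k (fun _ => (0 : X)) g := by simpa using (habs 0).exists
  obtain ⟨ρ, Λ, c, hρm, hρi, hadd, hΛ, hint, hle, hc⟩ := exists_densities hconv habs hφk
  obtain ⟨b, hbi, hbc, hρb⟩ := exists_integrable_gap (fun y => hf.measurable_apply (x₀ + y))
    (fun y => hf.2.mono fun t ht => ht.2.2.2 (x₀ + y)) h₀ hρm hadd hint hle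
  obtain ⟨m, hmρ, hm⟩ := exists_selection hXT hconv hbd hadd hρb
  have hΛc : Continuous Λ := by
    obtain ⟨M, hM, -⟩ := EReal.lt_iff_exists_real_btwn.1 hx₀.2.1
    refine continuous_of_bddAbove_near Λ.toAddMonoidHom (g := 0)
      (N := M + (ε - r + φ (x - x₀)) - c) ?_
    filter_upwards [hlimx₀.eventually (hx₀.2.2.eventually (gt_mem_nhds hM))] with y hy
    obtain ⟨g, hg, hgM⟩ := exists_majorant_of_integralFun_lt hy
    have h1 := hle (SimpleFunc.const T y) g hg
    have h2 := EReal.coe_lt_coe_iff.1 hgM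
    simp only [SimpleFunc.const_apply, ← hΛ] at h1
    change Λ y ≤ _
    linarith
  have hmi : ∀ y, Integrable (fun t => m t y) μ := fun y => (hρi y).congr
    ((hmρ y).mono fun t ht => ht.symm)
  have hmΛ : ∀ y, Λ y = ∫ t, m t y ∂μ := fun y => (hΛ y).trans
    (integral_congr_ae ((hmρ y).mono fun t ht => ht.symm))
  -- The defect of `m t` as a subgradient of `f t` at `x`.
  let l₀ : T → ℝ := fun t => (f t x).toReal - m t (x - x₀) + b t
  have hl₀i : Integrable l₀ μ := (hxi.sub (hmi _)).add hbi
  have hl₀ : ∀ᵐ t ∂μ, 0 ≤ l₀ t := by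
    filter_upwards [hm, hxe] with t h1 h2
    have := h1 (x - x₀)
    simp only [k, add_sub_cancel] at this
    rw [h2, EReal.coe_le_coe_iff] at this
    simp only [l₀]
    linarith
  have hll₀ : ∀ᵐ t ∂μ, max (l₀ t) 0 = l₀ t := hl₀.mono fun t ht => max_eq_left ht
  have hlint : ∫ t, max (l₀ t) 0 ∂μ = r - Λ (x - x₀) + ∫ t, b t ∂μ := by
    have hd : Integrable (fun t => (f t x).toReal - m t (x - x₀)) μ := hxi.sub (hmi _)
    rw [integral_congr_ae hll₀, hmΛ, hr, ← integral_sub hxi (hmi _), ← integral_add hd hbi]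
  have hnormal : ∀ y ∈ effDom (integralFun μ f),
      (φ - ⟨Λ, hΛc⟩ : X →L[ℝ] ℝ) (y - x) ≤ ε - ∫ t, max (l₀ t) 0 ∂μ := by
    intro y hy
    obtain ⟨g, hg, -⟩ := exists_majorant_of_integralFun_lt hy
    have h1 := hc (y - x₀) g (by simpa [IsIntegrableMajorant, k] using hg)
    simp only [ContinuousLinearMap.coe_coe, map_sub] at h1
    simp only [hlint, _root_.sub_apply, ContinuousLinearMap.coe_mk', map_sub]
      at hbc ⊢
    linarith
  -- Truncation at `0` changes `l₀` only on a null set and makes it nonnegative everywhere.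
  refine ⟨fun t => max (l₀ t) 0, hl₀i.congr (hll₀.mono fun t ht => ht.symm),
    fun t => le_max_right _ _, ?_, ⟨Λ, hΛc⟩, ⟨m, hmi, ?_, hmΛ⟩,
    mem_epsNormal_iff.2 ⟨hxdom, hnormal⟩⟩
  · simpa using hnormal x hxdom
  · filter_upwards [hm, hxe, hll₀] with t h1 h2 h3
    rw [h3, mem_epsSubdiff_iff_of_eq_coe h2]
    intro y
    have := h1 (y - x₀)
    simp only [k, add_sub_cancel] at this
    refine le_trans (EReal.coe_le_coe_iff.2 ?_) this
    simp only [l₀, map_sub]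
    linarith

end Subdifferential

theorem IsSuslinSpace.separableSpace {X : Type*} [TopologicalSpace X] (h : IsSuslinSpace X) :
    TopologicalSpace.SeparableSpace X := by
  obtain ⟨-, P, _, _, g, hg, hgs⟩ := h
  exact hgs.denseRange.separableSpace hg

end ConvexIntegral

theorem mainTheorem1
    {X : Type*} [AddCommGroup X] [Module ℝ X] [TopologicalSpace X] [IsTopologicalAddGroup X]
    [ContinuousSMul ℝ X] [LocallyConvexSpace ℝ X] [T2Space X]
    {T : Type*} [MeasurableSpace T] (μ : Measure T) [μ.IsComplete] [SigmaFinite μ]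
    (f : T → X → EReal) (hf : ConvexIntegral.IsConvexNormalIntegrand μ f)
    (hXT : ConvexIntegral.IsSuslinSpace X ∨ Nonempty (T ≃ᵐ ℕ))
    (hI : ∃ x₀, ConvexIntegral.IsContinuityPoint (ConvexIntegral.integralFun μ f) x₀)
    (hft : ∀ᵐ t ∂μ, ∃ x₀, ConvexIntegral.IsContinuityPoint (f t) x₀)
    (x : X) (ε : ℝ) (hε : 0 ≤ ε) :
    ConvexIntegral.epsSubdiff (ConvexIntegral.integralFun μ f) ε x =
      ⋃ (ε₁ : ℝ) (ε₂ : ℝ) (_ : 0 ≤ ε₁ ∧ 0 ≤ ε₂ ∧ ε = ε₁ + ε₂)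
        (l : T → ℝ) (_ : l ∈ ConvexIntegral.nonnegIntegrableLE μ ε₁),
        (ConvexIntegral.weakIntegral μ (fun t => ConvexIntegral.epsSubdiff (f t) (l t) x) +
          ConvexIntegral.epsNormal
            (ConvexIntegral.effDom (ConvexIntegral.integralFun μ f)) ε₂ x) := by
  obtain ⟨x₀, hx₀⟩ := hI
  have hXT' : TopologicalSpace.SeparableSpace X ∨ Countable T :=
    hXT.imp (fun h => h.separableSpace) fun ⟨e⟩ => e.injective.countable
  ext φ
  simp only [mem_iUnion]
  constructor
  · intro hφ
    obtain ⟨l, hl, hl0, hlε, φ₁, h₁, h₂⟩ :=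
      ConvexIntegral.exists_decomposition_of_mem_epsSubdiff hf hXT' hx₀ hft hφ
    exact ⟨∫ t, l t ∂μ, ε - ∫ t, l t ∂μ, ⟨integral_nonneg hl0, sub_nonneg.2 hlε, by ring⟩, l,
      ⟨hl, hl0, le_rfl⟩, φ₁, h₁, φ - φ₁, h₂, by simp⟩
  · rintro ⟨ε₁, ε₂, ⟨-, -, rfl⟩, l, hl, φ₁, h₁, φ₂, h₂, rfl⟩
    exact ConvexIntegral.add_mem_epsSubdiff_integralFun hf hx₀ hl h₁ h₂
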